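/- There are absolute constants $C>0$ and $k\in\mathbb N$ such that the following holds. Let $H\ge 1$, $N\ge 1$, let $\mathcal S$ be a state space with $|\mathcal S|=3$ and $\mathcal A$ a finite non-empty action set, and let an episodic MDP of horizon $H$ be given by an initial distribution $\rho$ on $\mathcal S$ and time-dependent transition kernels $P_t(\cdot\mid s,a)$, $1\le t<H$. For a (randomized, time-dependent) policy $\pi$ write $\Pr_\pi$ for the law of the trajectory $(s_1,a_1,\dots,s_H,a_H)$ and $J_{\mathbf r}(\pi)=\mathbb E_\pi\big[\sum_{t=1}^H \mathbf r_t(s_t,a_t)\big]$. Then there is a learner, depending on $\rho,(P_t),N$ but neither on the expert nor on a reward function, which maps every dataset $D$ of $N$ trajectories to a policy $\widehat\pi=\widehat\pi(D)$, such that for every deterministic time-dependent expert policy $\pi^*$: 1. (Sample splitting.) If all actions recorded in $D$ are those of $\pi^*$, then at each time $t$ and each state $s$ that is visited at time $t$ in one of the first $\lfloor N/2\rfloor$ trajectories of $D$, $\widehat\pi$ plays the action $\pi^*_t(s)$ with probability one. 2. (Bias at the final step.) If $D$ consists of $N$ independent trajectories drawn from $\Pr_{\pi^*}$, then $$\frac12\sum_{s\in\mathcal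 S}\sum_{a\in\mathcal A}\Big|\mathbb E_D\big[\Pr_{\widehat\pi(D)}(s_H=s,a_H=a)\big]-\Pr_{\pi^*}(s_H=s,a_H=a)\Big|\le \frac{C\,(1+\log(NH))^k}{N}.$$ 3. (Suboptimality at the final step.) For every reward function $\mathbf r$ with values in $[0,1]$ and $\mathbf r_t=0$ for all $t<H$, $$\big|J_{\mathbf r}(\pi^*)-\mathbb E_D[J_{\mathbf r}(\widehat\pi(D))]\big|\le \frac{C\,(1+\log(NH))^k}{N}.$$ That is, with known transitions every 3-state MDP admits a learner whose bias and suboptimality at the final step are $\widetilde O(1/N)$. -/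

import Mathlib

noncomputable section

/-- A tabular episodic MDP (without reward) of horizon `H = T + 1`, with time-dependent
transitions. The decision times are `0, …, T`, and `P t s a` is the law of the state at time
`t + 1` given the state `s` and the action `a` at time `t`. -/
structure EpisodicMDP (S A : Type) [Fintype S] (T : ℕ) where
  ρ : S → ℝ
  P : Fin T → S → A → S → ℝ
  ρ_nonneg : ∀ s, 0 ≤ ρ s
  ρ_sum : ∑ s, ρ s = 1
  P_nonneg : ∀ t s a s', 0 ≤ P t s a s'
  P_sum : ∀ t s a, ∑ s', P t s a s' = 1

/-- A (randomized, time-dependent) policy: `prob t s a = π_t(a | s)`. -/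
structure RandPolicy (S A : Type) [Fintype A] (T : ℕ) where
  prob : Fin (T + 1) → S → A → ℝ
  prob_nonneg : ∀ t s a, 0 ≤ prob t s a
  prob_sum : ∀ t s, ∑ a, prob t s a = 1

/-- A deterministic time-dependent policy. -/
abbrev DetPolicy (S A : Type) (T : ℕ) := Fin (T + 1) → S → A

/-- A trajectory `(s_t, a_t)_{t = 0, …, T}`. -/
abbrev Traj (S A : Type) (T : ℕ) := Fin (T + 1) → S × A

/-- A dataset of `N` trajectories. -/
abbrev Dataset (S A : Type) (T N : ℕ) := Fin N → Traj S A T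

/-- A learner maps datasets to policies. It sees only the dataset; since it may be chosen
after the MDP, it knows the initial law and the transitions. -/
abbrev Learner (S A : Type) [Fintype A] (T N : ℕ) := Dataset S A T N → RandPolicy S A T

variable {S A : Type} [Fintype S] [DecidableEq S] [Fintype A] [DecidableEq A] {T N : ℕ}

/-- A deterministic policy regarded as a randomized one. -/
def DetPolicy.toRand (π : DetPolicy S A T) : RandPolicy S A T where
  prob t s a := if a = π t s then 1 else 0
  prob_nonneg t s a := by split_ifs <;> norm_num
  prob_sum t s := by simp

namespace EpisodicMDP

/-- The probability of a trajectory when the policy `π` is played. -/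
def trajProb (M : EpisodicMDP S A T) (π : RandPolicy S A T) (τ : Traj S A T) : ℝ :=
  M.ρ (τ 0).1 * (∏ t : Fin T, M.P t (τ t.castSucc).1 (τ t.castSucc).2 (τ t.succ).1) *
    ∏ t : Fin (T + 1), π.prob t (τ t).1 (τ t).2

/-- `Pr_π(s_t = s, a_t = a)`. -/
def occ (M : EpisodicMDP S A T) (π : RandPolicy S A T) (t : Fin (T + 1)) (s : S) (a : A) : ℝ :=
  ∑ τ : Traj S A T, if τ t = (s, a) then M.trajProb π τ else 0

/-- `J_r(π)`, the expected total reward of `π` for the reward function `r`. -/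
def value (M : EpisodicMDP S A T) (r : Fin (T + 1) → S → A → ℝ) (π : RandPolicy S A T) : ℝ :=
  ∑ τ : Traj S A T, M.trajProb π τ * ∑ t : Fin (T + 1), r t (τ t).1 (τ t).2

/-- The expectation of `F D` over a dataset `D` of `N` independent trajectories of `π`. -/
def dataExp (M : EpisodicMDP S A T) (π : RandPolicy S A T) (F : Dataset S A T N → ℝ) : ℝ :=
  ∑ D : Dataset S A T N, (∏ i, M.trajProb π (D i)) * F D

end EpisodicMDP

/-- The total variation distance of two mass functions on `S × A`. -/
def tvDist (p q : S → A → ℝ) : ℝ := (1 / 2) * ∑ s, ∑ a, |p s a - q s a|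

/-- `π` plays the expert's action `πE t s` with probability one at every time `t` and state `s`
such that `s` is visited at time `t` in one of the first `⌊N / 2⌋` trajectories of `D`. -/
def MimicsFirstHalf (πE : DetPolicy S A T) (D : Dataset S A T N) (π : RandPolicy S A T) : Prop :=
  ∀ i : Fin N, (i : ℕ) < N / 2 → ∀ t : Fin (T + 1), π.prob t (D i t).1 (πE t (D i t).1) = 1

/-- Every action recorded in `D` is the one that `πE` plays. -/
def PlayedBy (πE : DetPolicy S A T) (D : Dataset S A T N) : Prop :=
  ∀ i t, (D i t).2 = πE t (D i t).1

end

/-!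
The learner plays the expert's action at every time and state that is visited in the first half of
the data. With high probability, each of the remaining (unobserved) states is visited by the expert
with probability at most `δ ≈ log (N H) / N`. Let `t₁` be the last time with an unobserved state.
After `t₁` all actions are prescribed, and apart from the unobserved ones at most two states are
left at time `t₁`. Up to `O(δ)`, the final law is hence an affine function of the probability of a
single state `c` at time `t₁`, and it suffices to match that probability in expectation over the
second half of the data.

The probabilities of `c` under the policies that extend the observed actions and visit the
unobserved states at time `t₁` with probability `O(δ)` form an interval with some end points `h'`
and `h`. An unbiased estimate that lies in it with high probability can be realized by a policy, up
to an arbitrarily small error, so that its bias is small although its fluctuations need not be. The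
optimal value minus the regret of the trajectory estimates the probability of `c` without bias and
has mean at most `h`, because the regret is nonnegative; a Lagrange multiplier for the bound on the
visits to the unobserved states provides room of order `δ` below `h`. The exponential moments of the
regret are controlled by its mean, so that the fluctuations of the sample mean are small compared
with `h - h'`. Replacing `c` by its complement gives an estimate that stays above `h'`. One block of
samples decides which of the two estimates is applied to another block, which by independence does
not affect the expectation.
-/

noncomputable section

section Expectation

theorem indicator_one_nonneg {X : Type*} (s : Set X) (x : X) : (0 : ℝ) ≤ s.indicator 1 x :=
  Set.indicator_nonneg (fun _ _ => zero_le_one) x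

theorem indicator_one_mem_Icc {X : Type*} (s : Set X) (x : X) :
    s.indicator 1 x ∈ Set.Icc (0 : ℝ) 1 :=
  ⟨indicator_one_nonneg s x, Set.indicator_le_self' (fun _ _ => zero_le_one) x⟩

variable {X Y ι : Type*} [Fintype X] [Fintype Y] {w F G : X → ℝ}

/-- The expectation of `F` under the mass function `w`. Mass functions are elements of
`stdSimplex ℝ X`. -/
def expect (w F : X → ℝ) : ℝ := ∑ x, w x * F x

theorem expect_add (w F G : X → ℝ) :
    expect w (fun x => F x + G x) = expect w F + expect w G := by
  simp only [expect, mul_add, Finset.sum_add_distrib]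

theorem expect_sub (w F G : X → ℝ) :
    expect w (fun x => F x - G x) = expect w F - expect w G := by
  simp only [expect, mul_sub, Finset.sum_sub_distrib]

theorem expect_neg (w F : X → ℝ) : expect w (fun x => -F x) = -expect w F := by
  simp only [expect, mul_neg, Finset.sum_neg_distrib]

theorem expect_const_mul (w : X → ℝ) (c : ℝ) (F : X → ℝ) :
    expect w (fun x => c * F x) = c * expect w F := by
  simp only [expect, Finset.mul_sum, mul_left_comm]

theorem expect_mul_const (w F : X → ℝ) (c : ℝ) :
    expect w (fun x => F x * c) = expect w F * c := by
  simp only [expect, Finset.sum_mul, mul_assoc]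

theorem expect_sum (w : X → ℝ) (s : Finset ι) (F : ι → X → ℝ) :
    expect w (fun x => ∑ i ∈ s, F i x) = ∑ i ∈ s, expect w (F i) := by
  simp only [expect, Finset.mul_sum]
  exact Finset.sum_comm

theorem expect_const (hw : w ∈ stdSimplex ℝ X) (c : ℝ) : expect w (fun _ => c) = c := by
  simp only [expect, ← Finset.sum_mul, hw.2, one_mul]

theorem expect_mono_of_ne_zero (hw : 0 ≤ w) (h : ∀ x, w x ≠ 0 → F x ≤ G x) :
    expect w F ≤ expect w G :=
  Finset.sum_le_sum fun x _ => by
    obtain hx | hx := eq_or_ne (w x) 0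
    · simp only [hx, zero_mul, le_refl]
    · exact mul_le_mul_of_nonneg_left (h x hx) (hw x)

theorem expect_mono (hw : 0 ≤ w) (h : ∀ x, F x ≤ G x) : expect w F ≤ expect w G :=
  expect_mono_of_ne_zero hw fun x _ => h x

theorem expect_nonneg (hw : 0 ≤ w) (hF : ∀ x, 0 ≤ F x) : 0 ≤ expect w F :=
  Finset.sum_nonneg fun x _ => mul_nonneg (hw x) (hF x)

theorem expect_le_of_forall_le (hw : w ∈ stdSimplex ℝ X) {c : ℝ} (h : ∀ x, F x ≤ c) :
    expect w F ≤ c :=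
  (expect_mono hw.1 h).trans_eq (expect_const hw c)

theorem le_expect_of_forall_le (hw : w ∈ stdSimplex ℝ X) {c : ℝ} (h : ∀ x, c ≤ F x) :
    c ≤ expect w F :=
  (expect_const hw c).symm.trans_le (expect_mono hw.1 h)

theorem expect_mem_Icc (hw : w ∈ stdSimplex ℝ X) {a b : ℝ} (h : ∀ x, F x ∈ Set.Icc a b) :
    expect w F ∈ Set.Icc a b :=
  ⟨le_expect_of_forall_le hw fun x => (h x).1, expect_le_of_forall_le hw fun x => (h x).2⟩

theorem abs_expect_le (hw : 0 ≤ w) : |expect w F| ≤ expect w fun x => |F x| :=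
  (Finset.abs_sum_le_sum_abs _ _).trans_eq <|
    Finset.sum_congr rfl fun x _ => by rw [abs_mul, abs_of_nonneg (hw x)]

theorem abs_expect_le_of_forall_abs_le (hw : w ∈ stdSimplex ℝ X) {c : ℝ}
    (h : ∀ x, |F x| ≤ c) : |expect w F| ≤ c :=
  (abs_expect_le hw.1).trans (expect_le_of_forall_le hw h)

theorem expect_expect (w : X → ℝ) (K : X → Y → ℝ) (F : Y → ℝ) :
    expect (fun y => expect w fun x => K x y) F = expect w fun x => expect (K x) F := by
  simp only [expect, Finset.sum_mul, Finset.mul_sum, mul_assoc]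
  exact Finset.sum_comm

theorem isLinearMap_expect (F : X → ℝ) : IsLinearMap ℝ fun w => expect w F := by
  constructor <;> intros <;>
    simp only [expect, Pi.add_apply, Pi.smul_apply, add_mul, smul_mul_assoc,
      Finset.sum_add_distrib, Finset.smul_sum]

theorem expect_mem_stdSimplex (hw : w ∈ stdSimplex ℝ X) {K : X → Y → ℝ}
    (hK : ∀ x, K x ∈ stdSimplex ℝ Y) : (fun y => expect w fun x => K x y) ∈ stdSimplex ℝ Y := by
  refine ⟨fun y => expect_nonneg hw.1 fun x => (hK x).1 y, ?_⟩
  calc ∑ y, expect w (fun x => K x y)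
      = expect (fun y => expect w fun x => K x y) fun _ => 1 := by simp only [expect, mul_one]
    _ = 1 := by simp only [expect_expect, expect_const (hK _), expect_const hw]

/-- The probability of the event `s` under the mass function `w`. -/
def prob (w : X → ℝ) (s : Set X) : ℝ := expect w (s.indicator 1)

theorem prob_nonneg (hw : 0 ≤ w) (s : Set X) : 0 ≤ prob w s :=
  expect_nonneg hw (indicator_one_nonneg s)

theorem prob_le_expect_of_ne_zero (hw : 0 ≤ w) {s : Set X} (hF : ∀ x, w x ≠ 0 → 0 ≤ F x)
    (hs : ∀ x ∈ s, w x ≠ 0 → 1 ≤ F x) : prob w s ≤ expect w F :=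
  expect_mono_of_ne_zero hw fun x hx => by
    by_cases hxs : x ∈ s
    · simpa only [Set.indicator_of_mem hxs, Pi.one_apply] using hs x hxs hx
    · simpa only [Set.indicator_of_notMem hxs] using hF x hx

theorem prob_le_expect (hw : 0 ≤ w) {s : Set X} (hF : ∀ x, 0 ≤ F x) (hs : ∀ x ∈ s, 1 ≤ F x) :
    prob w s ≤ expect w F :=
  prob_le_expect_of_ne_zero hw (fun x _ => hF x) fun x hx _ => hs x hx

theorem prob_mono_of_ne_zero (hw : 0 ≤ w) {s t : Set X} (h : ∀ x, w x ≠ 0 → x ∈ s → x ∈ t) :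
    prob w s ≤ prob w t :=
  prob_le_expect_of_ne_zero hw (fun x _ => indicator_one_nonneg t x) fun x hxs hx =>
    (Set.indicator_of_mem (h x hx hxs) (1 : X → ℝ)).ge

theorem prob_mono (hw : 0 ≤ w) {s t : Set X} (h : s ⊆ t) : prob w s ≤ prob w t :=
  prob_mono_of_ne_zero hw fun _ _ hx => h hx

theorem prob_le_one (hw : w ∈ stdSimplex ℝ X) (s : Set X) : prob w s ≤ 1 :=
  (prob_le_expect hw.1 (fun _ => zero_le_one) fun _ _ => le_rfl).trans_eq (expect_const hw 1)

theorem prob_compl (hw : w ∈ stdSimplex ℝ X) (s : Set X) : prob w sᶜ = 1 - prob w s := by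
  rw [eq_sub_iff_add_eq', prob, prob, ← expect_add, ← expect_const hw 1]
  exact congrArg (expect w) (Set.indicator_self_add_compl s (1 : X → ℝ))

theorem prob_singleton (w : X → ℝ) (a : X) : prob w {a} = w a := by
  classical simp [prob, expect, Set.indicator_apply]

theorem prob_le_card_mul {s : Set X} {δ : ℝ} (hδ : 0 ≤ δ) (h : ∀ x ∈ s, w x ≤ δ) :
    prob w s ≤ Fintype.card X * δ := by
  rw [← nsmul_eq_mul]
  refine Finset.sum_le_card_nsmul _ _ _ fun x _ => ?_
  by_cases hx : x ∈ s
  · simpa only [Set.indicator_of_mem hx, Pi.one_apply, mul_one] using h x hx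
  · simpa only [Set.indicator_of_notMem hx, mul_zero] using hδ

theorem prob_iUnion_le [Fintype ι] (hw : 0 ≤ w) (s : ι → Set X) :
    prob w (⋃ i, s i) ≤ ∑ i, prob w (s i) := by
  simp only [prob, ← expect_sum]
  refine prob_le_expect hw (fun x => Finset.sum_nonneg fun i _ => indicator_one_nonneg (s i) x)
    fun x hx => ?_
  obtain ⟨i, hi⟩ := Set.mem_iUnion.1 hx
  rw [← Pi.one_apply (M := fun _ : X => ℝ) x, ← Set.indicator_of_mem hi (1 : X → ℝ)]
  exact Finset.single_le_sum (fun j _ => indicator_one_nonneg (s j) x) (Finset.mem_univ i)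

theorem prob_union_le (hw : 0 ≤ w) (s t : Set X) : prob w (s ∪ t) ≤ prob w s + prob w t := by
  rw [Set.union_eq_iUnion]
  exact (prob_iUnion_le hw _).trans_eq (Fintype.sum_bool _)

theorem expect_le_add_mul_prob (hw : w ∈ stdSimplex ℝ X) {s : Set X} {a K : ℝ}
    (hs : ∀ x, w x ≠ 0 → x ∉ s → F x ≤ a) (hF : ∀ x, F x ≤ a + K) :
    expect w F ≤ a + K * prob w s := by
  nth_rw 1 [prob, ← expect_const hw a]
  rw [← expect_const_mul, ← expect_add]
  refine expect_mono_of_ne_zero hw.1 fun x hx => ?_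
  by_cases hxs : x ∈ s
  · simpa only [Set.indicator_of_mem hxs, Pi.one_apply, mul_one] using hF x
  · simpa only [Set.indicator_of_notMem hxs, mul_zero, add_zero] using hs x hx hxs

end Expectation

section Iid

variable {X ι : Type*} [Fintype X] [Fintype ι] [DecidableEq ι] {w : X → ℝ} {f : X → ℝ}

/-- The law of a family of independent samples, each with mass function `w`. -/
def iidMass (w : X → ℝ) (D : ι → X) : ℝ := ∏ i, w (D i)

theorem ne_zero_of_iidMass_ne_zero {X ι : Type*} [Fintype ι] {w : X → ℝ}
    {D : ι → X} (h : iidMass w D ≠ 0) (i : ι) : w (D i) ≠ 0 :=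
  Finset.prod_ne_zero_iff.1 h i (Finset.mem_univ i)

theorem expect_iidMass_prod (hw : w ∈ stdSimplex ℝ X) (I : Finset ι) (g : X → ℝ) :
    expect (iidMass w) (fun D => ∏ i ∈ I, g (D i)) = expect w g ^ I.card := by
  have factor (D : ι → X) :
      iidMass w D * ∏ i ∈ I, g (D i) = ∏ i, w (D i) * if i ∈ I then g (D i) else 1 := by
    rw [iidMass, Finset.prod_mul_distrib, Fintype.prod_ite_mem]
  calc ∑ D, iidMass w D * ∏ i ∈ I, g (D i)
      = ∏ i : ι, ∑ x, w x * if i ∈ I then g x else 1 := by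
        simp only [factor, Finset.prod_univ_sum, Fintype.piFinset_univ]
    _ = ∏ i : ι, if i ∈ I then expect w g else 1 := by
        refine Finset.prod_congr rfl fun i _ => ?_
        split_ifs
        · rfl
        · simpa only [mul_one] using hw.2
    _ = expect w g ^ I.card := by rw [Fintype.prod_ite_mem, Finset.prod_const]

theorem iidMass_mem_stdSimplex (hw : w ∈ stdSimplex ℝ X) :
    iidMass w ∈ stdSimplex ℝ (ι → X) := by
  refine ⟨fun D => Finset.prod_nonneg fun i _ => hw.1 (D i), ?_⟩
  simpa only [expect, Finset.prod_empty, mul_one, Finset.card_empty, pow_zero] using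
    expect_iidMass_prod (ι := ι) hw ∅ 1

theorem expect_iidMass_apply (hw : w ∈ stdSimplex ℝ X) (i : ι) (f : X → ℝ) :
    expect (iidMass w) (fun D : ι → X => f (D i)) = expect w f := by
  simpa only [Finset.prod_singleton, Finset.card_singleton, pow_one] using
    expect_iidMass_prod hw {i} f

theorem iidMass_piecewise_mul {X : Type*} (w : X → ℝ) (J : Finset ι) (D D' : ι → X) :
    iidMass w (J.piecewise D D') * iidMass w (J.piecewise D' D) = iidMass w D * iidMass w D' := by
  simp only [iidMass, ← Finset.prod_mul_distrib]
  refine Finset.prod_congr rfl fun i _ => ?_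
  by_cases hi : i ∈ J
  · simp only [Finset.piecewise_eq_of_mem _ _ _ hi]
  · simp only [Finset.piecewise_eq_of_notMem _ _ _ hi, mul_comm]

/-- Exchanging the samples outside `J` of two independent families preserves their joint law. -/
theorem expect_iidMass_piecewise (hw : w ∈ stdSimplex ℝ X) (J : Finset ι) (F : (ι → X) → ℝ) :
    expect (iidMass w) (fun D => expect (iidMass w) fun D' => F (J.piecewise D D')) =
      expect (iidMass w) F := by
  have exchange_involutive : Function.Involutive fun p : (ι → X) × (ι → X) =>
      (J.piecewise p.1 p.2, J.piecewise p.2 p.1) := fun p => by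
    simp only [Finset.piecewise_idem_left, Finset.piecewise_idem_right, Finset.piecewise_same]
  calc ∑ D, iidMass w D * ∑ D', iidMass w D' * F (J.piecewise D D')
      = ∑ p : (ι → X) × (ι → X), iidMass w p.1 * iidMass w p.2 * F (J.piecewise p.1 p.2) := by
        simp only [Finset.mul_sum, ← mul_assoc, Fintype.sum_prod_type]
    _ = ∑ p : (ι → X) × (ι → X), iidMass w p.1 * iidMass w p.2 * F p.1 :=
        Fintype.sum_equiv exchange_involutive.toPerm _ _ fun p => by
          rw [← iidMass_piecewise_mul w J]; rfl
    _ = expect (iidMass w) F := by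
        simp only [Fintype.sum_prod_type, mul_right_comm, ← Finset.mul_sum,
          (iidMass_mem_stdSimplex hw).2, mul_one, expect]

theorem expect_iidMass_mul (hw : w ∈ stdSimplex ℝ X) {I J : Finset ι} (hIJ : Disjoint J I)
    {F G : (ι → X) → ℝ} (hF : DependsOn F (J : Set ι)) (hG : DependsOn G (I : Set ι)) :
    expect (iidMass w) (fun D => F D * G D) = expect (iidMass w) F * expect (iidMass w) G := by
  have separate (D D' : ι → X) :
      F (J.piecewise D D') * G (J.piecewise D D') = F D * G D' := by
    congr 1
    · exact hF fun i hi => Finset.piecewise_eq_of_mem _ _ _ hi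
    · exact hG fun i hi =>
        Finset.piecewise_eq_of_notMem _ _ _ (Finset.disjoint_right.1 hIJ hi)
  rw [← expect_iidMass_piecewise hw J]
  simp only [separate, expect_const_mul, expect_mul_const]

theorem prob_le_sum_le_exp (hw : w ∈ stdSimplex ℝ X) (I : Finset ι) {b : ℝ} (c : ℝ)
    (hf : expect w (fun x => Real.exp (f x)) ≤ Real.exp b) :
    prob (iidMass w) {D : ι → X | c ≤ ∑ i ∈ I, f (D i)} ≤ Real.exp (I.card * b - c) := by
  have hwι : iidMass w ∈ stdSimplex ℝ (ι → X) := iidMass_mem_stdSimplex hw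
  calc prob (iidMass w) {D : ι → X | c ≤ ∑ i ∈ I, f (D i)}
      ≤ expect (iidMass w) fun D => (∏ i ∈ I, Real.exp (f (D i))) * Real.exp (-c) := by
        refine prob_le_expect hwι.1 (fun D => by positivity) fun D hD => ?_
        rw [← Real.exp_sum, ← Real.exp_add]
        exact Real.one_le_exp (by linarith [show c ≤ _ from hD])
    _ = expect w (fun x => Real.exp (f x)) ^ I.card * Real.exp (-c) := by
        rw [expect_mul_const, expect_iidMass_prod hw I fun x => Real.exp (f x)]
    _ ≤ Real.exp b ^ I.card * Real.exp (-c) := by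
        gcongr
        exact expect_nonneg hw.1 fun x => (Real.exp_pos _).le
    _ = Real.exp (I.card * b - c) := by
        rw [← Real.exp_nat_mul, ← Real.exp_add, sub_eq_add_neg]

theorem prob_forall_notMem_le_exp (hw : w ∈ stdSimplex ℝ X) (I : Finset ι) (s : Set X) :
    prob (iidMass w) {D : ι → X | ∀ i ∈ I, D i ∉ s} ≤ Real.exp (-(I.card * prob w s)) := by
  calc prob (iidMass w) {D : ι → X | ∀ i ∈ I, D i ∉ s}
      ≤ expect (iidMass w) fun D => ∏ i ∈ I, sᶜ.indicator 1 (D i) :=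
        prob_le_expect (iidMass_mem_stdSimplex hw).1
          (fun D => Finset.prod_nonneg fun i _ => indicator_one_nonneg _ _) fun D hD =>
          (Finset.prod_eq_one fun i hi => Set.indicator_of_mem (hD i hi) 1).ge
    _ = (1 - prob w s) ^ I.card := by rw [expect_iidMass_prod hw, ← prob, prob_compl hw]
    _ ≤ Real.exp (-prob w s) ^ I.card :=
        pow_le_pow_left₀ (sub_nonneg.2 (prob_le_one hw s)) (Real.one_sub_le_exp_neg _) _
    _ = Real.exp (-(I.card * prob w s)) := by rw [← Real.exp_nat_mul, mul_neg]

end Iid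

section SampleMean

variable {X ι : Type*} {I J : Finset ι} {w F G : X → ℝ}

/-- The mean of `F` over the samples with index in `I`. -/
def sampleMean (I : Finset ι) (F : X → ℝ) (D : ι → X) : ℝ := (∑ i ∈ I, F (D i)) / I.card

theorem dependsOn_sampleMean (I : Finset ι) (F : X → ℝ) : DependsOn (sampleMean I F) I :=
  fun D D' h => by
    rw [sampleMean, sampleMean, Finset.sum_congr rfl fun i hi => congrArg F (h i hi)]

theorem sampleMean_nonneg {D : ι → X} (hF : ∀ i ∈ I, 0 ≤ F (D i)) : 0 ≤ sampleMean I F D :=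
  div_nonneg (Finset.sum_nonneg hF) (Nat.cast_nonneg _)

theorem abs_sampleMean_le (hI : I.Nonempty) {B : ℝ} {D : ι → X}
    (hF : ∀ i ∈ I, |F (D i)| ≤ B) : |sampleMean I F D| ≤ B := by
  have card_pos : (0 : ℝ) < I.card := Nat.cast_pos.2 hI.card_pos
  rw [sampleMean, abs_div, abs_of_pos card_pos, div_le_iff₀ card_pos, mul_comm, ← nsmul_eq_mul]
  exact (Finset.abs_sum_le_sum_abs _ _).trans (Finset.sum_le_card_nsmul _ _ _ hF)

variable [Fintype X] [Fintype ι] [DecidableEq ι]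

theorem expect_sampleMean (hw : w ∈ stdSimplex ℝ X) (hI : I.Nonempty) (F : X → ℝ) :
    expect (iidMass w) (sampleMean I F) = expect w F := by
  have card_ne_zero : (I.card : ℝ) ≠ 0 := Nat.cast_ne_zero.2 hI.card_ne_zero
  have eq_mul_inv (D : ι → X) :
      sampleMean I F D = (∑ i ∈ I, F (D i)) * (I.card : ℝ)⁻¹ :=
    div_eq_mul_inv _ _
  rw [funext eq_mul_inv, expect_mul_const, expect_sum,
    Finset.sum_congr rfl fun i _ => expect_iidMass_apply hw i F, Finset.sum_const,
    nsmul_eq_mul, mul_right_comm, mul_inv_cancel₀ card_ne_zero, one_mul]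

open Classical in
theorem expect_ite_sampleMean (hw : w ∈ stdSimplex ℝ X) (hI : I.Nonempty) (hJI : Disjoint J I)
    {E : Set (ι → X)} (hE : DependsOn (· ∈ E) (J : Set ι)) {p : ℝ} (hF : expect w F = p)
    (hG : expect w G = p) :
    expect (iidMass w) (fun D => if D ∈ E then sampleMean I F D else sampleMean I G D) = p := by
  have split (D : ι → X) : (if D ∈ E then sampleMean I F D else sampleMean I G D) =
      E.indicator 1 D * (sampleMean I F D - sampleMean I G D) + sampleMean I G D := by
    rw [Set.indicator_apply]
    split_ifs <;> simp
  have hInd : DependsOn (E.indicator (1 : (ι → X) → ℝ)) J := fun D D' h => by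
    simp only [Set.indicator_apply, show (D ∈ E) = (D' ∈ E) from hE h, Pi.one_apply]
  have hDiff : DependsOn (fun D => sampleMean I F D - sampleMean I G D) I := fun D D' h => by
    simp only [dependsOn_sampleMean I F h, dependsOn_sampleMean I G h]
  simp only [split, expect_add, expect_iidMass_mul hw hJI hInd hDiff, expect_sub,
    expect_sampleMean hw hI, hF, hG, sub_self, mul_zero, zero_add]

theorem prob_le_sampleMean_le_exp (hw : w ∈ stdSimplex ℝ X) (hI : I.Nonempty) {δ : ℝ}
    (hF : ∀ x, F x ∈ Set.Icc 0 1) (hδ : expect w F ≤ δ) :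
    prob (iidMass w) {D : ι → X | 4 * δ ≤ sampleMean I F D} ≤ Real.exp (-(I.card * (2 * δ))) := by
  have exp_le (x : X) : Real.exp (F x) ≤ 1 + 2 * F x := by
    have := Real.abs_exp_sub_one_le (abs_le.2 ⟨by linarith [(hF x).1], (hF x).2⟩)
    rw [abs_of_nonneg (hF x).1] at this
    linarith [le_abs_self (Real.exp (F x) - 1)]
  have moment : expect w (fun x => Real.exp (F x)) ≤ Real.exp (2 * δ) := by
    calc expect w (fun x => Real.exp (F x))
        ≤ expect w fun x => 1 + 2 * F x := expect_mono hw.1 exp_le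
      _ = 1 + 2 * expect w F := by rw [expect_add, expect_const hw, expect_const_mul]
      _ ≤ Real.exp (2 * δ) := by linarith [Real.add_one_le_exp (2 * δ)]
  simp only [sampleMean, le_div_iff₀ (show (0 : ℝ) < I.card from Nat.cast_pos.2 hI.card_pos)]
  refine (prob_le_sum_le_exp hw I _ moment).trans_eq ?_
  ring_nf

end SampleMean

section Convex

theorem exists_lagrange_multiplier {K : Set (ℝ × ℝ)} (hK : Convex ℝ K) {c h : ℝ}
    (hslater : ∃ z ∈ K, z.2 < c) (hmax : ∀ z ∈ K, z.2 ≤ c → z.1 ≤ h) :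
    ∃ l : ℝ, 0 ≤ l ∧ ∀ z ∈ K, z.1 - l * z.2 ≤ h - l * c := by
  have slope_le {z z' : ℝ × ℝ} (hz : z ∈ K) (hz' : z' ∈ K) (hc : c < z.2) (hc' : z'.2 < c) :
      (z.1 - h) / (z.2 - c) ≤ (h - z'.1) / (c - z'.2) := by
    have gap_pos : 0 < z.2 - z'.2 := by linarith
    have combo := hK hz hz' (a := (c - z'.2) / (z.2 - z'.2)) (b := (z.2 - c) / (z.2 - z'.2))
      (div_nonneg (by linarith) gap_pos.le) (div_nonneg (by linarith) gap_pos.le)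
      (by field_simp; ring)
    have := hmax _ combo (by
      simp only [Prod.snd_add, Prod.smul_snd, smul_eq_mul]; field_simp; linarith)
    simp only [Prod.fst_add, Prod.smul_fst, smul_eq_mul] at this
    rw [div_mul_eq_mul_div, div_mul_eq_mul_div, ← add_div, div_le_iff₀ gap_pos] at this
    rw [div_le_div_iff₀ (by linarith) (by linarith)]
    linarith
  obtain ⟨z₀, hz₀, hc₀⟩ := hslater
  obtain ⟨l, hlower, hupper⟩ := exists_between_of_forall_le
    (s := insert 0 ((fun z : ℝ × ℝ => (z.1 - h) / (z.2 - c)) '' {z ∈ K | c < z.2}))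
    (t := (fun z : ℝ × ℝ => (h - z.1) / (c - z.2)) '' {z ∈ K | z.2 < c})
    (Set.insert_nonempty _ _) ⟨_, z₀, ⟨hz₀, hc₀⟩, rfl⟩ <| by
      rintro _ (rfl | ⟨z, ⟨hz, hc⟩, rfl⟩) _ ⟨z', ⟨hz', hc'⟩, rfl⟩
      · exact div_nonneg (sub_nonneg.2 (hmax z' hz' hc'.le)) (sub_nonneg.2 hc'.le)
      · exact slope_le hz hz' hc hc'
  refine ⟨l, hlower (Set.mem_insert _ _), fun z hz => ?_⟩
  obtain hc | hc | hc := lt_trichotomy z.2 c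
  · have := hupper ⟨z, ⟨hz, hc⟩, rfl⟩
    rw [le_div_iff₀ (sub_pos.2 hc)] at this
    linarith
  · rw [hc]
    linarith [hmax z hz hc.le]
  · have := hlower (Set.mem_insert_of_mem _ ⟨z, ⟨hz, hc⟩, rfl⟩)
    rw [div_le_iff₀ (sub_pos.2 hc)] at this
    linarith

theorem exists_mem_segment_smul_eq {E : Type*} [AddCommGroup E] [Module ℝ E] {x y : ℝ}
    (hx : 0 ≤ x) (hy : 0 ≤ y) (p q : E) :
    ∃ r ∈ segment ℝ p q, (x + y) • r = x • p + y • q := by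
  obtain hxy | hxy := (add_nonneg hx hy).eq_or_lt'
  · obtain ⟨rfl, rfl⟩ := (add_eq_zero_iff_of_nonneg hx hy).1 hxy
    exact ⟨p, left_mem_segment ℝ p q, by simp only [add_zero, zero_smul]⟩
  · refine ⟨(x / (x + y)) • p + (y / (x + y)) • q,
      ⟨_, _, div_nonneg hx hxy.le, div_nonneg hy hxy.le, ?_, rfl⟩, ?_⟩
    · rw [← add_div, div_self hxy.ne']
    · rw [smul_add, smul_smul, smul_smul, mul_div_cancel₀ _ hxy.ne', mul_div_cancel₀ _ hxy.ne']

theorem exists_mem_abs_sub_le {K : Set ℝ} (hK : Convex ℝ K) (hne : K.Nonempty) {v ε : ℝ}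
    (hv : v ∈ Set.Icc (sInf K) (sSup K)) (hε : 0 < ε) : ∃ x ∈ K, |x - v| ≤ ε := by
  obtain ⟨x, hxK, hx⟩ := exists_lt_of_lt_csSup hne (show v - ε < sSup K by linarith [hv.2])
  obtain ⟨y, hyK, hy⟩ := exists_lt_of_csInf_lt hne (show sInf K < v + ε by linarith [hv.1])
  by_contra! far
  have hvK : v ∈ K := hK.ordConnected.out hyK hxK ⟨?_, ?_⟩
  · exact (far v hvK).not_ge (by simpa using hε.le)
  · by_contra! hlt
    exact (far y hyK).not_ge (abs_le.2 ⟨by linarith, by linarith⟩)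
  · by_contra! hlt
    exact (far x hxK).not_ge (abs_le.2 ⟨by linarith, by linarith⟩)

end Convex

section Test

variable {X : Type*} [Fintype X]

theorem abs_expect_sub_expect_le {m d v : X → ℝ} (hm : m ∈ stdSimplex ℝ X)
    (hd : d ∈ stdSimplex ℝ X) (hv : ∀ x, v x ∈ Set.Icc 0 1) {c : X} {U : Set X}
    (hU : ({c}ᶜ ∩ Uᶜ).Subsingleton) :
    |expect m v - expect d v| ≤ |m c - d c| + prob m U + prob d U := by
  classical
  obtain ⟨b, hb, hvb⟩ : ∃ b ∈ Set.Icc (0 : ℝ) 1, ∀ x, x ≠ c → x ∉ U → v x = b := by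
    obtain hempty | ⟨x, hx⟩ := ({c}ᶜ ∩ Uᶜ).eq_empty_or_nonempty
    · exact ⟨v c, hv c, fun x hxc hxU => (hempty.subset ⟨hxc, hxU⟩ : x ∈ (∅ : Set X)).elim⟩
    · exact ⟨v x, hv x, fun y hyc hyU => congrArg v (hU ⟨hyc, hyU⟩ hx)⟩
  have centered : expect m v - expect d v = ∑ x, (m x - d x) * (v x - b) := by
    calc expect m v - expect d v = expect m (fun x => v x - b) - expect d fun x => v x - b := by
          rw [expect_sub, expect_sub, expect_const hm, expect_const hd]; ring
      _ = ∑ x, (m x - d x) * (v x - b) := by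
          simp only [expect, ← Finset.sum_sub_distrib, sub_mul]
  have term_le (x : X) : |(m x - d x) * (v x - b)| ≤
      (if x = c then |m x - d x| else 0) + m x * U.indicator 1 x + d x * U.indicator 1 x := by
    have hdiff : |m x - d x| * |v x - b| ≤ |m x - d x| :=
      mul_le_of_le_one_right (abs_nonneg _)
        (abs_le.2 ⟨by linarith [(hv x).1, hb.2], by linarith [(hv x).2, hb.1]⟩)
    have hsum : |m x - d x| ≤ m x + d x :=
      abs_le.2 ⟨by linarith [hm.1 x], by linarith [hd.1 x]⟩
    rw [abs_mul, Set.indicator_apply]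
    split_ifs with hxc hxU hxU
    · simp only [Pi.one_apply]
      linarith [hm.1 x, hd.1 x]
    · linarith
    · simp only [Pi.one_apply]
      linarith
    · simp only [hvb x hxc hxU, sub_self, abs_zero, mul_zero, add_zero, le_refl]
  calc |expect m v - expect d v|
      ≤ ∑ x, |(m x - d x) * (v x - b)| := centered ▸ Finset.abs_sum_le_sum_abs _ _
    _ ≤ _ := Finset.sum_le_sum fun x _ => term_le x
    _ = |m c - d c| + prob m U + prob d U := by
        rw [Finset.sum_add_distrib, Finset.sum_add_distrib, Finset.sum_ite_eq' Finset.univ c]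
        simp only [Finset.mem_univ, if_true, prob, expect]

theorem exists_subsingleton_compl_inter (hX : Fintype.card X ≤ 3) {U : Set X} (hU : U.Nonempty) :
    ∃ c, ({c}ᶜ ∩ Uᶜ).Subsingleton := by
  classical
  obtain ⟨b, hb⟩ := hU
  obtain hfull | ⟨c, hc⟩ := Uᶜ.eq_empty_or_nonempty
  · exact ⟨b, by simp only [hfull, Set.inter_empty, Set.subsingleton_empty]⟩
  · refine ⟨c, fun x hx y hy => by_contra fun hxy => ?_⟩
    have four_le : ({b, c, x, y} : Finset X).card ≤ 3 := (Finset.card_le_univ _).trans hX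
    have hbU {z : X} (hz : z ∈ Uᶜ) : b ≠ z := fun h => hz (h ▸ hb)
    rw [Finset.card_insert_of_notMem (by simp [hbU hc, hbU hx.2, hbU hy.2]),
      Finset.card_insert_of_notMem (by simpa using ⟨Ne.symm hx.1, Ne.symm hy.1⟩),
      Finset.card_pair hxy] at four_le
    omega

end Test

section Trajectories

variable {S A : Type} {T : ℕ}

theorem RandPolicy.prob_mem_stdSimplex [Fintype A] (π : RandPolicy S A T) (t : Fin (T + 1))
    (s : S) : π.prob t s ∈ stdSimplex ℝ A :=
  ⟨π.prob_nonneg t s, π.prob_sum t s⟩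

/-- The policy without its last time. -/
def RandPolicy.trunc [Fintype A] (π : RandPolicy S A (T + 1)) : RandPolicy S A T where
  prob t := π.prob t.castSucc
  prob_nonneg t := π.prob_nonneg t.castSucc
  prob_sum t := π.prob_sum t.castSucc

namespace EpisodicMDP

variable [Fintype S]

theorem ρ_mem_stdSimplex (M : EpisodicMDP S A T) : M.ρ ∈ stdSimplex ℝ S :=
  ⟨M.ρ_nonneg, M.ρ_sum⟩

theorem P_mem_stdSimplex (M : EpisodicMDP S A T) (t : Fin T) (s : S) (a : A) :
    M.P t s a ∈ stdSimplex ℝ S :=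
  ⟨M.P_nonneg t s a, M.P_sum t s a⟩

/-- The MDP without its last time. -/
def trunc (M : EpisodicMDP S A (T + 1)) : EpisodicMDP S A T where
  ρ := M.ρ
  P t := M.P t.castSucc
  ρ_nonneg := M.ρ_nonneg
  ρ_sum := M.ρ_sum
  P_nonneg t := M.P_nonneg t.castSucc
  P_sum t := M.P_sum t.castSucc

variable [Fintype A]

theorem trajProb_snoc (M : EpisodicMDP S A (T + 1)) (π : RandPolicy S A (T + 1))
    (τ : Traj S A T) (x : S × A) :
    M.trajProb π (Fin.snoc (α := fun _ => S × A) τ x) = M.trunc.trajProb π.trunc τ *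
      (M.P (Fin.last T) (τ (Fin.last T)).1 (τ (Fin.last T)).2 x.1 *
        π.prob (Fin.last (T + 1)) x.1 x.2) := by
  have snoc_zero : (Fin.snoc (α := fun _ => S × A) τ x : Traj S A (T + 1)) 0 = τ 0 := by
    rw [← Fin.castSucc_zero, Fin.snoc_castSucc (α := fun _ => S × A)]
  have snoc_last :
      (Fin.snoc (α := fun _ => S × A) τ x : Traj S A (T + 1)) (Fin.last T).succ = x := by
    rw [Fin.succ_last, Fin.snoc_last (α := fun _ => S × A)]
  rw [trajProb, trajProb, Fin.prod_univ_castSucc, Fin.prod_univ_castSucc (n := T + 1)]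
  simp only [Fin.snoc_castSucc (α := fun _ => S × A), Fin.snoc_last (α := fun _ => S × A),
    snoc_zero, snoc_last, Fin.succ_castSucc, trunc, RandPolicy.trunc]
  ring

theorem expect_trajProb_succ (M : EpisodicMDP S A (T + 1)) (π : RandPolicy S A (T + 1))
    (F : Traj S A (T + 1) → ℝ) :
    expect (M.trajProb π) F = expect (M.trunc.trajProb π.trunc) fun τ =>
      expect (M.P (Fin.last T) (τ (Fin.last T)).1 (τ (Fin.last T)).2) fun s =>
        expect (π.prob (Fin.last (T + 1)) s) fun a =>
          F (Fin.snoc (α := fun _ => S × A) τ (s, a)) := by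
  simp only [expect, Finset.mul_sum]
  rw [← (Fin.snocEquiv fun _ : Fin (T + 2) => S × A).sum_comp, Fintype.sum_prod_type,
    Finset.sum_comm]
  refine Finset.sum_congr rfl fun τ _ => ?_
  rw [Fintype.sum_prod_type]
  refine Finset.sum_congr rfl fun s _ => Finset.sum_congr rfl fun a _ => ?_
  rw [Fin.snocEquiv, Equiv.coe_fn_mk, trajProb_snoc]
  ring

theorem expect_trajProb_zero (M : EpisodicMDP S A 0) (π : RandPolicy S A 0)
    (F : Traj S A 0 → ℝ) :
    expect (M.trajProb π) F =
      expect M.ρ fun s => expect (π.prob 0 s) fun a => F fun _ => (s, a) := by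
  simp only [expect, Finset.mul_sum]
  rw [← (Equiv.funUnique (Fin 1) (S × A)).symm.sum_comp, Fintype.sum_prod_type]
  refine Finset.sum_congr rfl fun s _ => Finset.sum_congr rfl fun a _ => ?_
  have constant : (uniqueElim (s, a) : Fin 1 → S × A) = fun _ => (s, a) :=
    funext fun _ => uniqueElim_const _ _
  simp [trajProb, constant, mul_assoc]

/-- The law `s ↦ Pr_π(s_t = s)` of the state at time `t`, computed forward in time. -/
def stateDist (M : EpisodicMDP S A T) (π : RandPolicy S A T) (t : Fin (T + 1)) : S → ℝ :=
  Fin.induction (motive := fun _ => S → ℝ) M.ρ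
    (fun t d s' => expect d fun s => expect (π.prob t.castSucc s) fun a => M.P t s a s') t

theorem stateDist_zero (M : EpisodicMDP S A T) (π : RandPolicy S A T) : M.stateDist π 0 = M.ρ :=
  rfl

theorem stateDist_succ (M : EpisodicMDP S A T) (π : RandPolicy S A T) (t : Fin T) :
    M.stateDist π t.succ = fun s' => expect (M.stateDist π t.castSucc) fun s =>
      expect (π.prob t.castSucc s) fun a => M.P t s a s' :=
  rfl

theorem expect_stateDist_succ (M : EpisodicMDP S A T) (π : RandPolicy S A T) (t : Fin T)
    (f : S → ℝ) :
    expect (M.stateDist π t.succ) f = expect (M.stateDist π t.castSucc) fun s =>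
      expect (π.prob t.castSucc s) fun a => expect (M.P t s a) f := by
  simp only [stateDist_succ, expect_expect]

theorem stateDist_mem_stdSimplex (M : EpisodicMDP S A T) (π : RandPolicy S A T)
    (t : Fin (T + 1)) : M.stateDist π t ∈ stdSimplex ℝ S := by
  induction t using Fin.induction with
  | zero => exact M.ρ_mem_stdSimplex
  | succ t ih =>
    exact expect_mem_stdSimplex ih fun s =>
      expect_mem_stdSimplex (π.prob_mem_stdSimplex _ s) fun a => M.P_mem_stdSimplex t s a

theorem stateDist_trunc (M : EpisodicMDP S A (T + 1)) (π : RandPolicy S A (T + 1))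
    (t : Fin (T + 1)) : M.trunc.stateDist π.trunc t = M.stateDist π t.castSucc := by
  induction t using Fin.induction with
  | zero => rfl
  | succ t ih => rw [stateDist_succ, ih, ← Fin.succ_castSucc, stateDist_succ]; rfl

theorem expect_trajProb_apply (M : EpisodicMDP S A T) (π : RandPolicy S A T) (t : Fin (T + 1))
    (f : S × A → ℝ) :
    expect (M.trajProb π) (fun τ => f (τ t)) =
      expect (M.stateDist π t) fun s => expect (π.prob t s) fun a => f (s, a) := by
  induction T generalizing f with
  | zero => rw [expect_trajProb_zero, Fin.fin_one_eq_zero t, stateDist_zero]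
  | succ T ih =>
    rw [expect_trajProb_succ]
    cases t using Fin.lastCases with
    | last =>
      simp only [Fin.snoc_last (α := fun _ => S × A)]
      rw [ih M.trunc π.trunc (Fin.last T) (fun x => expect (M.P (Fin.last T) x.1 x.2) fun s =>
          expect (π.prob (Fin.last (T + 1)) s) fun a => f (s, a)),
        stateDist_trunc, ← Fin.succ_last, expect_stateDist_succ]
      rfl
    | cast t =>
      simp only [Fin.snoc_castSucc (α := fun _ => S × A),
        expect_const (π.prob_mem_stdSimplex _ _), expect_const (M.P_mem_stdSimplex _ _ _)]
      rw [ih M.trunc π.trunc t, stateDist_trunc]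
      rfl

theorem trajProb_mem_stdSimplex (M : EpisodicMDP S A T) (π : RandPolicy S A T) :
    M.trajProb π ∈ stdSimplex ℝ (Traj S A T) := by
  refine ⟨fun τ => mul_nonneg (mul_nonneg (M.ρ_nonneg _) (Finset.prod_nonneg fun _ _ =>
    M.P_nonneg _ _ _ _)) (Finset.prod_nonneg fun _ _ => π.prob_nonneg _ _ _), ?_⟩
  have total := M.expect_trajProb_apply π 0 fun _ => 1
  simpa only [expect, mul_one, π.prob_sum, (M.stateDist_mem_stdSimplex π 0).2] using total

theorem expect_trajProb_state (M : EpisodicMDP S A T) (π : RandPolicy S A T) (t : Fin (T + 1))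
    (f : S → ℝ) : expect (M.trajProb π) (fun τ => f (τ t).1) = expect (M.stateDist π t) f := by
  simpa only [expect_const (π.prob_mem_stdSimplex t _)] using
    M.expect_trajProb_apply π t fun x => f x.1

/-- The expectation of the reward `r` of the last state and action. -/
def terminalValue (M : EpisodicMDP S A T) (π : RandPolicy S A T) (r : S → A → ℝ) : ℝ :=
  expect (M.stateDist π (Fin.last T)) fun s => expect (π.prob (Fin.last T) s) (r s)

theorem terminalValue_mem_Icc (M : EpisodicMDP S A T) (π : RandPolicy S A T) {r : S → A → ℝ}
    {a b : ℝ} (hr : ∀ s x, r s x ∈ Set.Icc a b) : M.terminalValue π r ∈ Set.Icc a b :=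
  expect_mem_Icc (M.stateDist_mem_stdSimplex π _) fun s =>
    expect_mem_Icc (π.prob_mem_stdSimplex _ s) (hr s)

theorem value_eq_terminalValue (M : EpisodicMDP S A T) (π : RandPolicy S A T)
    {r : Fin (T + 1) → S → A → ℝ} (hr : ∀ t s a, t ≠ Fin.last T → r t s a = 0) :
    M.value r π = M.terminalValue π (r (Fin.last T)) := by
  calc M.value r π = expect (M.trajProb π) fun τ =>
        r (Fin.last T) (τ (Fin.last T)).1 (τ (Fin.last T)).2 :=
        congrArg (expect (M.trajProb π)) <| funext fun τ =>
          Finset.sum_eq_single _ (fun t _ ht => hr t _ _ ht) (by simp)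
    _ = M.terminalValue π (r (Fin.last T)) :=
        M.expect_trajProb_apply π (Fin.last T) fun x => r (Fin.last T) x.1 x.2

theorem occ_eq_stateDist_mul [DecidableEq S] [DecidableEq A] (M : EpisodicMDP S A T)
    (π : RandPolicy S A T) (t : Fin (T + 1)) (s : S) (a : A) :
    M.occ π t s a = M.stateDist π t s * π.prob t s a := by
  calc M.occ π t s a = expect (M.trajProb π) fun τ => if τ t = (s, a) then 1 else 0 := by
        simp only [occ, expect, mul_ite, mul_one, mul_zero]
    _ = expect (M.stateDist π t) fun s' => expect (π.prob t s') fun b =>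
          if (s', b) = (s, a) then 1 else 0 :=
        M.expect_trajProb_apply π t fun x => if x = (s, a) then 1 else 0
    _ = M.stateDist π t s * π.prob t s a := by
        simp [expect, ite_and]

theorem sum_occ_mul [DecidableEq S] [DecidableEq A] (M : EpisodicMDP S A T)
    (π : RandPolicy S A T) (r : S → A → ℝ) :
    ∑ s, ∑ a, M.occ π (Fin.last T) s a * r s a = M.terminalValue π r := by
  simp only [occ_eq_stateDist_mul, terminalValue, expect, Finset.mul_sum, mul_assoc]

/-- Backward induction: `W t` dominates the conditional expectation of the factors from time `t` on,
given the state at time `t`. -/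
theorem expect_trajProb_prod_mul_le (M : EpisodicMDP S A T) (π : RandPolicy S A T)
    {φ : Fin T → S → A → ℝ} {f : S → A → ℝ} {W : Fin (T + 1) → S → ℝ}
    (hφ : ∀ t s a, 0 ≤ φ t s a)
    (hlast : ∀ s, expect (π.prob (Fin.last T) s) (f s) ≤ W (Fin.last T) s)
    (hstep : ∀ t s, expect (π.prob t.castSucc s)
      (fun a => φ t s a * expect (M.P t s a) (W t.succ)) ≤ W t.castSucc s) :
    expect (M.trajProb π) (fun τ => (∏ t : Fin T, φ t (τ t.castSucc).1 (τ t.castSucc).2) *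
      f (τ (Fin.last T)).1 (τ (Fin.last T)).2) ≤ expect M.ρ (W 0) := by
  induction T generalizing f with
  | zero =>
    simp only [expect_trajProb_zero, Finset.univ_eq_empty, Finset.prod_empty, one_mul]
    exact expect_mono M.ρ_nonneg hlast
  | succ T ih =>
    rw [expect_trajProb_succ]
    simp only [Fin.prod_univ_castSucc, Fin.snoc_castSucc (α := fun _ => S × A),
      Fin.snoc_last (α := fun _ => S × A), expect_const_mul, mul_assoc]
    refine ih M.trunc π.trunc (W := fun t => W t.castSucc)
      (f := fun s a => φ (Fin.last T) s a * expect (M.P (Fin.last T) s a) fun s' =>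
        expect (π.prob (Fin.last (T + 1)) s') (f s'))
      (fun t => hφ t.castSucc) (fun s => ?_) fun t => hstep t.castSucc
    refine le_trans (expect_mono (π.prob_nonneg _ s) fun a => ?_) (hstep (Fin.last T) s)
    exact mul_le_mul_of_nonneg_left (expect_mono (M.P_nonneg _ s a) hlast) (hφ _ s a)

end EpisodicMDP

end Trajectories

theorem eq_pi_single_of_mem_stdSimplex {X : Type*} [Fintype X] [DecidableEq X] {p : X → ℝ}
    (hp : p ∈ stdSimplex ℝ X) {a : X} (ha : p a = 1) : p = Pi.single a 1 := by
  funext b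
  obtain rfl | hba := eq_or_ne b a
  · rw [ha, Pi.single_eq_same]
  · have pair_le : p b + p a ≤ 1 := by
      rw [← Finset.sum_pair hba, ← hp.2]
      exact Finset.sum_le_univ_sum_of_nonneg hp.1
    rw [Pi.single_eq_of_ne hba]
    exact le_antisymm (by linarith) (hp.1 b)

section PartialPolicies

variable {S A : Type} {T : ℕ}

/-- A prescription of some of the actions of a deterministic policy; the value `none` at `(t, s)`
leaves the action at time `t` in state `s` open. -/
abbrev PartialPolicy (S A : Type) (T : ℕ) := Fin (T + 1) → S → Option A

/-- The policy `π` plays every action that `κ` prescribes. -/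
def DetPolicy.Extends (π : DetPolicy S A T) (κ : PartialPolicy S A T) : Prop :=
  ∀ t s, ∀ a ∈ κ t s, π t s = a

theorem DetPolicy.exists_extends [Nonempty A] (κ : PartialPolicy S A T) :
    ∃ π : DetPolicy S A T, DetPolicy.Extends π κ :=
  ⟨fun t s => (κ t s).getD (Classical.arbitrary A), fun _ _ _ ha =>
    congrArg (Option.getD · (Classical.arbitrary A)) ha⟩

variable [Fintype A]

/-- The policy `π` plays every action that `κ` prescribes with probability one. -/
def RandPolicy.Extends (π : RandPolicy S A T) (κ : PartialPolicy S A T) : Prop :=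
  ∀ t s, ∀ a ∈ κ t s, π.prob t s a = 1

theorem DetPolicy.Extends.toRand [DecidableEq A] {π : DetPolicy S A T} {κ : PartialPolicy S A T}
    (hπ : DetPolicy.Extends π κ) : π.toRand.Extends κ :=
  fun t s a ha => if_pos (hπ t s a ha).symm

theorem RandPolicy.Extends.prob_congr {π π' : RandPolicy S A T} {κ : PartialPolicy S A T}
    (hπ : π.Extends κ) (hπ' : π'.Extends κ) {t : Fin (T + 1)} {s : S} (hs : κ t s ≠ none) :
    π.prob t s = π'.prob t s := by
  classical
  obtain ⟨a, ha⟩ := Option.ne_none_iff_exists'.1 hs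
  rw [eq_pi_single_of_mem_stdSimplex (π.prob_mem_stdSimplex t s) (hπ t s a ha),
    eq_pi_single_of_mem_stdSimplex (π'.prob_mem_stdSimplex t s) (hπ' t s a ha)]

theorem RandPolicy.exists_prob_mem_segment {κ : PartialPolicy S A T} {π π' : RandPolicy S A T}
    (hπ : π.Extends κ) (hπ' : π'.Extends κ) {x y : Fin (T + 1) → S → ℝ} (hx : ∀ t s, 0 ≤ x t s)
    (hy : ∀ t s, 0 ≤ y t s) :
    ∃ σ : RandPolicy S A T, σ.Extends κ ∧
      ∀ t s, (x t s + y t s) • σ.prob t s = x t s • π.prob t s + y t s • π'.prob t s := by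
  choose q hq hmix using fun t s =>
    exists_mem_segment_smul_eq (hx t s) (hy t s) (π.prob t s) (π'.prob t s)
  have hqΔ (t s) : q t s ∈ stdSimplex ℝ A := (convex_stdSimplex ℝ A).segment_subset
    (π.prob_mem_stdSimplex t s) (π'.prob_mem_stdSimplex t s) (hq t s)
  refine ⟨⟨q, fun t s => (hqΔ t s).1, fun t s => (hqΔ t s).2⟩, fun t s a ha => ?_, hmix⟩
  have hqa := hq t s
  rw [hπ.prob_congr hπ' (ne_of_eq_of_ne ha (Option.some_ne_none a)), segment_same] at hqa
  exact (congrFun hqa a).trans (hπ' t s a ha)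

namespace EpisodicMDP

variable [Fintype S]

/-- The laws of the state at time `t` under the policies that extend `κ`. -/
def attainable (M : EpisodicMDP S A T) (κ : PartialPolicy S A T) (t : Fin (T + 1)) :
    Set (S → ℝ) :=
  {d | ∃ π : RandPolicy S A T, π.Extends κ ∧ M.stateDist π t = d}

/-- In each state and at each time, mix the two policies in the proportion of their weighted
probabilities of being there. -/
theorem convex_attainable (M : EpisodicMDP S A T) (κ : PartialPolicy S A T) (t : Fin (T + 1)) :
    Convex ℝ (M.attainable κ t) := by
  rintro _ ⟨π, hπ, rfl⟩ _ ⟨π', hπ', rfl⟩ x y hx hy hxy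
  obtain ⟨σ, hσ, hmix⟩ := RandPolicy.exists_prob_mem_segment hπ hπ'
    (fun t s => mul_nonneg hx ((M.stateDist_mem_stdSimplex π t).1 s))
    (fun t s => mul_nonneg hy ((M.stateDist_mem_stdSimplex π' t).1 s))
  refine ⟨σ, hσ, ?_⟩
  induction t using Fin.induction with
  | zero => simp only [stateDist_zero, ← add_smul, hxy, one_smul]
  | succ t ih =>
    funext s'
    simp only [stateDist_succ, ih, Pi.add_apply, Pi.smul_apply, smul_eq_mul, expect,
      Finset.mul_sum, ← Finset.sum_add_distrib]
    refine Finset.sum_congr rfl fun s _ => Finset.sum_congr rfl fun a _ => ?_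
    have hsa := congrFun (hmix t.castSucc s) a
    simp only [Pi.add_apply, Pi.smul_apply, smul_eq_mul] at hsa
    linear_combination M.P t s a s' * hsa

end EpisodicMDP

end PartialPolicies

section Values

variable {S A : Type} {T : ℕ} [Fintype S] [Fintype A]

namespace EpisodicMDP

/-- The expectation of `g` of the state at time `t₁` when `π` is played from time `t` and a given
state on; for `t ≥ t₁` it is `g` itself. -/
def valueFrom (M : EpisodicMDP S A T) (π : RandPolicy S A T) (t₁ : Fin (T + 1)) (g : S → ℝ)
    (t : Fin (T + 1)) : S → ℝ :=
  Fin.reverseInduction (motive := fun _ => S → ℝ) g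
    (fun t V s => if t.castSucc < t₁ then
      expect (π.prob t.castSucc s) fun a => expect (M.P t s a) V else g s) t

variable (M : EpisodicMDP S A T) (π : RandPolicy S A T) {t₁ : Fin (T + 1)} (g : S → ℝ)

theorem valueFrom_castSucc {t : Fin T} (ht : t.castSucc < t₁) (s : S) :
    M.valueFrom π t₁ g t.castSucc s =
      expect (π.prob t.castSucc s) fun a => expect (M.P t s a) (M.valueFrom π t₁ g t.succ) := by
  rw [valueFrom, Fin.reverseInduction_castSucc, if_pos ht]
  rfl

theorem valueFrom_of_le {t : Fin (T + 1)} (ht : t₁ ≤ t) : M.valueFrom π t₁ g t = g := by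
  cases t using Fin.lastCases with
  | last => rw [valueFrom, Fin.reverseInduction_last]
  | cast t => rw [valueFrom, Fin.reverseInduction_castSucc]; simp only [if_neg ht.not_gt]

theorem expect_stateDist_valueFrom {t : Fin (T + 1)} (ht : t ≤ t₁) :
    expect (M.stateDist π t) (M.valueFrom π t₁ g t) = expect (M.stateDist π t₁) g := by
  induction t using Fin.reverseInduction with
  | last => rw [valueFrom_of_le M π g (Fin.le_last t₁), Fin.last_le_iff.1 ht]
  | cast t ih =>
    obtain hlt | rfl := ht.lt_or_eq
    · rw [← ih (Fin.castSucc_lt_iff_succ_le.1 hlt), expect_stateDist_succ]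
      exact congrArg _ (funext fun s => M.valueFrom_castSucc π g hlt s)
    · rw [valueFrom_of_le M π g le_rfl]

variable {g}

theorem valueFrom_mem_Icc {a b : ℝ} (hg : ∀ s, g s ∈ Set.Icc a b) (t : Fin (T + 1)) (s : S) :
    M.valueFrom π t₁ g t s ∈ Set.Icc a b := by
  induction t using Fin.reverseInduction generalizing s with
  | last => rw [valueFrom_of_le M π g (Fin.le_last t₁)]; exact hg s
  | cast t ih =>
    by_cases ht : t.castSucc < t₁
    · rw [M.valueFrom_castSucc π g ht]
      exact expect_mem_Icc (π.prob_mem_stdSimplex _ s) fun a =>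
        expect_mem_Icc (M.P_mem_stdSimplex t s a) ih
    · rw [valueFrom_of_le M π g (not_lt.1 ht)]; exact hg s

end EpisodicMDP

end Values

section Regret

theorem sum_castSucc_sub_succ {n : ℕ} (h : Fin (n + 1) → ℝ) :
    ∑ t : Fin n, (h t.castSucc - h t.succ) = h 0 - h (Fin.last n) := by
  rw [Finset.sum_sub_distrib]
  linarith [Fin.sum_univ_castSucc h, Fin.sum_univ_succ h]

theorem exists_forall_le_of_option {A : Type*} [Finite A] [Nonempty A]
    (o : Option A) (f : A → ℝ) :
    ∃ a, (∀ b ∈ o, a = b) ∧ ∀ x, (∀ b ∈ o, x = b) → f x ≤ f a := by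
  cases o with
  | none =>
    obtain ⟨a, ha⟩ := Finite.exists_max f
    exact ⟨a, fun b hb => (Option.not_mem_none b hb).elim, fun x _ => ha x⟩
  | some a =>
    exact ⟨a, fun b hb => Option.mem_some.1 hb, fun x hx => by rw [hx a rfl]⟩

variable {S A : Type} {T : ℕ}

theorem DetPolicy.expect_toRand [Fintype A] [DecidableEq A] (π : DetPolicy S A T)
    (t : Fin (T + 1)) (s : S) (F : A → ℝ) : expect (π.toRand.prob t s) F = F (π t s) := by
  simp [expect, toRand]

namespace EpisodicMDP

variable [Fintype S]

section Loss

variable (M : EpisodicMDP S A T)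

/-- The expected decrease of the values `V` when `a` is played in state `s` at time `t < t₁`. -/
def loss (t₁ : Fin (T + 1)) (V : Fin (T + 1) → S → ℝ) (t : Fin T) (s : S) (a : A) : ℝ :=
  if t.castSucc < t₁ then V t.castSucc s - expect (M.P t s a) (V t.succ) else 0

/-- The sum of the losses of the actions played before time `t₁`. -/
def regret (t₁ : Fin (T + 1)) (V : Fin (T + 1) → S → ℝ) (τ : Traj S A T) : ℝ :=
  ∑ t : Fin T, M.loss t₁ V t (τ t.castSucc).1 (τ t.castSucc).2

theorem abs_loss_le {t₁ : Fin (T + 1)} {V : Fin (T + 1) → S → ℝ} {a b : ℝ} (hab : a ≤ b)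
    (hV : ∀ t s, V t s ∈ Set.Icc a b) (t : Fin T) (s : S) (x : A) :
    |M.loss t₁ V t s x| ≤ b - a := by
  unfold loss
  split_ifs
  · have next_mem := expect_mem_Icc (M.P_mem_stdSimplex t s x) (hV t.succ)
    exact abs_sub_le_of_le_of_le (hV _ s).1 (hV _ s).2 next_mem.1 next_mem.2
  · rw [abs_zero]; exact sub_nonneg.2 hab

end Loss

variable [Fintype A]

/-- The expectation of the reward `r` of the last state and action when `π` is played from time
`t` and a given state on. -/
def terminalValueFrom (M : EpisodicMDP S A T) (π : RandPolicy S A T) (r : S → A → ℝ)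
    (t : Fin (T + 1)) : S → ℝ :=
  M.valueFrom π (Fin.last T) (fun s => expect (π.prob (Fin.last T) s) (r s)) t

variable (M : EpisodicMDP S A T)

theorem expect_stateDist_terminalValueFrom (π : RandPolicy S A T) (r : S → A → ℝ)
    (t : Fin (T + 1)) :
    expect (M.stateDist π t) (M.terminalValueFrom π r t) = M.terminalValue π r :=
  M.expect_stateDist_valueFrom π _ (Fin.le_last t)

theorem terminalValueFrom_mem_Icc (π : RandPolicy S A T) {r : S → A → ℝ} {a b : ℝ}
    (hr : ∀ s x, r s x ∈ Set.Icc a b) (t : Fin (T + 1)) (s : S) :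
    M.terminalValueFrom π r t s ∈ Set.Icc a b :=
  M.valueFrom_mem_Icc π (fun s => expect_mem_Icc (π.prob_mem_stdSimplex _ s) (hr s)) t s

theorem terminalValueFrom_congr {κ : PartialPolicy S A T} {π π' : RandPolicy S A T}
    (hπ : π.Extends κ) (hπ' : π'.Extends κ) (r : S → A → ℝ) {t : Fin (T + 1)} {s : S}
    (hs : κ t s ≠ none) (hlater : ∀ t' s', t < t' → κ t' s' ≠ none) :
    M.terminalValueFrom π r t s = M.terminalValueFrom π' r t s := by
  induction t using Fin.reverseInduction generalizing s with
  | last => simp only [terminalValueFrom, valueFrom_of_le _ _ _ le_rfl, hπ.prob_congr hπ' hs]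
  | cast t ih =>
    have later_eq : M.terminalValueFrom π r t.succ = M.terminalValueFrom π' r t.succ :=
      funext fun s' => ih (hlater _ s' t.castSucc_lt_succ) fun t' s' ht' =>
        hlater t' s' (t.castSucc_lt_succ.trans ht')
    simp only [terminalValueFrom] at later_eq ⊢
    rw [valueFrom_castSucc _ _ _ (Fin.castSucc_lt_last t),
      valueFrom_castSucc _ _ _ (Fin.castSucc_lt_last t), later_eq, hπ.prob_congr hπ' hs]

theorem abs_terminalValue_sub_le {κ : PartialPolicy S A T} {π π' : RandPolicy S A T}
    (hπ : π.Extends κ) (hπ' : π'.Extends κ) {r : S → A → ℝ} (hr : ∀ s a, r s a ∈ Set.Icc 0 1)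
    {t : Fin (T + 1)} (hlater : ∀ t' s, t < t' → κ t' s ≠ none) :
    |M.terminalValue π r - expect (M.stateDist π t) (M.terminalValueFrom π' r t)| ≤
      prob (M.stateDist π t) {s | κ t s = none} := by
  have hd := (M.stateDist_mem_stdSimplex π t).1
  rw [← M.expect_stateDist_terminalValueFrom π r t, ← expect_sub]
  refine (abs_expect_le hd).trans (expect_mono hd fun s => ?_)
  by_cases hs : κ t s = none
  · rw [Set.indicator_of_mem (show s ∈ {s | κ t s = none} from hs)]
    exact abs_sub_le_of_nonneg_of_le (M.terminalValueFrom_mem_Icc π hr t s).1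
      (M.terminalValueFrom_mem_Icc π hr t s).2 (M.terminalValueFrom_mem_Icc π' hr t s).1
      (M.terminalValueFrom_mem_Icc π' hr t s).2
  · rw [M.terminalValueFrom_congr hπ hπ' r hs hlater, sub_self, abs_zero]
    exact indicator_one_nonneg _ s

/-- The performance difference lemma: the expected losses telescope. -/
theorem expect_regret (π : RandPolicy S A T) (t₁ : Fin (T + 1)) (V : Fin (T + 1) → S → ℝ) :
    expect (M.trajProb π) (M.regret t₁ V) =
      expect M.ρ (V 0) - expect (M.stateDist π t₁) (V t₁) := by
  have expect_loss (t : Fin T) :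
      expect (M.trajProb π) (fun τ => M.loss t₁ V t (τ t.castSucc).1 (τ t.castSucc).2) =
        expect (M.stateDist π (min t.castSucc t₁)) (V (min t.castSucc t₁)) -
          expect (M.stateDist π (min t.succ t₁)) (V (min t.succ t₁)) := by
    obtain ht | ht := lt_or_ge t.castSucc t₁
    · simp only [loss, if_pos ht, min_eq_left ht.le,
        min_eq_left (Fin.castSucc_lt_iff_succ_le.1 ht), expect_sub]
      rw [expect_trajProb_state, expect_stateDist_succ]
      exact congrArg _ (M.expect_trajProb_apply π t.castSucc fun x =>
        expect (M.P t x.1 x.2) (V t.succ))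
    · simp only [loss, if_neg ht.not_gt, min_eq_right ht,
        min_eq_right (ht.trans t.castSucc_lt_succ.le), sub_self,
        expect_const (M.trajProb_mem_stdSimplex π)]
  calc expect (M.trajProb π) (M.regret t₁ V)
      = ∑ t, expect (M.trajProb π) fun τ => M.loss t₁ V t (τ t.castSucc).1 (τ t.castSucc).2 :=
        expect_sum _ _ _
    _ = expect (M.stateDist π (min 0 t₁)) (V (min 0 t₁)) -
          expect (M.stateDist π (min (Fin.last T) t₁)) (V (min (Fin.last T) t₁)) := by
        simp only [expect_loss]
        exact sum_castSucc_sub_succ fun t => expect (M.stateDist π (min t t₁)) (V (min t t₁))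
    _ = expect M.ρ (V 0) - expect (M.stateDist π t₁) (V t₁) := by
        rw [min_eq_left (Fin.zero_le t₁), min_eq_right (Fin.le_last t₁), stateDist_zero]

/-- Dynamic programming: play the allowed action of least loss. -/
theorem exists_extends_forall_loss_nonneg [Nonempty A] [DecidableEq A] (κ : PartialPolicy S A T)
    (t₁ : Fin (T + 1)) (g : S → ℝ) :
    ∃ π : DetPolicy S A T, DetPolicy.Extends π κ ∧ ∀ t s a, (∀ b ∈ κ t.castSucc s, a = b) →
      0 ≤ M.loss t₁ (M.valueFrom π.toRand t₁ g) t s a := by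
  choose greedy greedy_allowed greedy_max using exists_forall_le_of_option (A := A)
  let V (t : Fin (T + 1)) : S → ℝ := Fin.reverseInduction (motive := fun _ => S → ℝ) g
    (fun t V s => if t.castSucc < t₁ then
      expect (M.P t s (greedy (κ t.castSucc s) fun a => expect (M.P t s a) V)) V else g s) t
  let π : DetPolicy S A T := fun t s => greedy (κ t s) <| Fin.lastCases (motive := fun _ => A → ℝ)
    0 (fun t a => expect (M.P t s a) (V t.succ)) t
  have π_castSucc (t : Fin T) (s : S) : π t.castSucc s =
      greedy (κ t.castSucc s) fun a => expect (M.P t s a) (V t.succ) := by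
    simp only [π, Fin.lastCases_castSucc]
  have V_castSucc (t : Fin T) (s : S) : V t.castSucc s =
      if t.castSucc < t₁ then expect (M.P t s (π t.castSucc s)) (V t.succ) else g s := by
    simp only [V, π_castSucc, Fin.reverseInduction_castSucc]
  have value_eq (t : Fin (T + 1)) : M.valueFrom π.toRand t₁ g t = V t := by
    induction t using Fin.reverseInduction with
    | last => simp only [V, valueFrom, Fin.reverseInduction_last]
    | cast t ih =>
      funext s
      rw [V_castSucc]
      split_ifs with ht
      · rw [M.valueFrom_castSucc _ _ ht, ih, DetPolicy.expect_toRand]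
      · rw [valueFrom_of_le _ _ _ (not_lt.1 ht)]
  refine ⟨π, fun t s a ha => greedy_allowed (κ t s) _ a ha, fun t s a ha => ?_⟩
  simp only [loss, value_eq]
  split_ifs with ht
  · rw [V_castSucc, if_pos ht, π_castSucc, sub_nonneg]
    exact greedy_max (κ t.castSucc s) (fun a => expect (M.P t s a) (V t.succ)) a ha
  · exact le_rfl

end EpisodicMDP

end Regret

section ExponentialMoment

/-- The correction `4 θ ^ 2 B` to the rate `θ` absorbs the second-order term of the exponential, so
that the bound can be iterated over nonnegative increments. -/
theorem exp_mul_mul_one_add_le {θ B x y : ℝ} (hθ : |θ| * B ≤ 1 / 4) (hx : x ∈ Set.Icc 0 B)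
    (hy : y ∈ Set.Icc 0 B) :
    Real.exp (θ * x) * (1 + (θ + 4 * θ ^ 2 * B) * y) ≤ 1 + (θ + 4 * θ ^ 2 * B) * (x + y) := by
  have hB : 0 ≤ B := hx.1.trans hx.2
  have abs_mul_le {z : ℝ} (hz : z ∈ Set.Icc 0 B) : |θ * z| ≤ 1 / 4 := by
    rw [abs_mul, abs_of_nonneg hz.1]
    exact (mul_le_mul_of_nonneg_left hz.2 (abs_nonneg θ)).trans hθ
  obtain ⟨hθB, hθB'⟩ := abs_le.1 (abs_mul_le ⟨hB, le_rfl⟩)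
  obtain ⟨hθy, -⟩ := abs_le.1 (abs_mul_le hy)
  have exp_le : Real.exp (θ * x) ≤ 1 + θ * x + θ ^ 2 * B * x := by
    have second_order :=
      (abs_le.1 (Real.abs_exp_sub_one_sub_id_le ((abs_mul_le hx).trans (by norm_num)))).2
    have sq_le : (θ * x) ^ 2 ≤ θ ^ 2 * B * x := by
      linear_combination θ ^ 2 * mul_le_mul_of_nonneg_right hx.2 hx.1
    linarith
  have factor_nonneg : 0 ≤ 1 + (θ + 4 * θ ^ 2 * B) * y := by
    have : (θ + 4 * θ ^ 2 * B) * y = (1 + 4 * (θ * B)) * (θ * y) := by ring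
    nlinarith
  have remainder_nonneg :
      0 ≤ θ ^ 2 * x * (3 * B - (1 + θ * B) * (1 + 4 * (θ * B)) * y) := by
    have coeff_le : (1 + θ * B) * (1 + 4 * (θ * B)) ≤ 3 := by nlinarith
    have : (1 + θ * B) * (1 + 4 * (θ * B)) * y ≤ 3 * y := mul_le_mul_of_nonneg_right coeff_le hy.1
    exact mul_nonneg (mul_nonneg (sq_nonneg θ) hx.1) (by linarith [hy.2])
  calc Real.exp (θ * x) * (1 + (θ + 4 * θ ^ 2 * B) * y)
      ≤ (1 + θ * x + θ ^ 2 * B * x) * (1 + (θ + 4 * θ ^ 2 * B) * y) :=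
        mul_le_mul_of_nonneg_right exp_le factor_nonneg
    _ ≤ 1 + (θ + 4 * θ ^ 2 * B) * (x + y) := by linear_combination remainder_nonneg

variable {X ι : Type*} [Fintype X] [Fintype ι] [DecidableEq ι]

theorem prob_le_abs_sampleMean_sub_le_exp {m F : X → ℝ} (hm : m ∈ stdSimplex ℝ X) {R B w : ℝ}
    (hB : 0 < B) (hexp : ∀ θ, |θ| * B ≤ 1 / 4 →
      expect m (fun x => Real.exp (θ * F x)) ≤ 1 + (θ + 4 * θ ^ 2 * B) * R)
    (hRw : R ≤ w) {I : Finset ι} (hI : I.Nonempty) :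
    prob (iidMass m) {D | w / 8 ≤ |sampleMean I F D - R|} ≤
      2 * Real.exp (-(I.card * (w / (1024 * B)))) := by
  have card_pos : (0 : ℝ) < I.card := Nat.cast_pos.2 hI.card_pos
  have one_sided {θ : ℝ} (hθ : |θ| = 1 / (64 * B)) :
      prob (iidMass m) {D | I.card * (θ * R + w / (512 * B)) ≤ ∑ i ∈ I, θ * F (D i)} ≤
        Real.exp (-(I.card * (w / (1024 * B)))) := by
    have small : |θ| * B ≤ 1 / 4 := by
      rw [hθ, show 1 / (64 * B) * B = 1 / 64 by field_simp]; norm_num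
    have correction : 4 * θ ^ 2 * B = 1 / (1024 * B) := by
      rw [← sq_abs, hθ]; field_simp; norm_num
    refine (prob_le_sum_le_exp hm I _ ((hexp θ small).trans ((add_comm _ _).trans_le
      (Real.add_one_le_exp _)))).trans (Real.exp_le_exp.2 ?_)
    have excess_le : 1 / (1024 * B) * R ≤ 1 / (1024 * B) * w :=
      mul_le_mul_of_nonneg_left hRw (by positivity)
    rw [correction]
    linear_combination (I.card : ℝ) * excess_le
  have upper := one_sided (θ := 1 / (64 * B)) (abs_of_pos (by positivity))
  have lower := one_sided (θ := -(1 / (64 * B))) (by rw [abs_neg]; exact abs_of_pos (by positivity))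
  have mass_nonneg := (iidMass_mem_stdSimplex (ι := ι) hm).1
  refine (prob_mono mass_nonneg fun D (hD : w / 8 ≤ |sampleMean I F D - R|) => ?_).trans
    ((prob_union_le mass_nonneg _ _).trans ((add_le_add upper lower).trans (two_mul _).ge))
  have sum_eq : ∑ i ∈ I, F (D i) = I.card * sampleMean I F D := by
    rw [sampleMean, mul_div_cancel₀ _ card_pos.ne']
  have scale : w / (512 * B) = 1 / (64 * B) * (w / 8) := by field_simp; ring
  have _ : 0 < 1 / (64 * B) := by positivity
  obtain hD | hD := le_abs.1 hD
  · left
    change _ ≤ ∑ i ∈ I, 1 / (64 * B) * F (D i)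
    rw [← Finset.mul_sum, sum_eq, scale]
    linear_combination (I.card : ℝ) * (1 / (64 * B)) * hD
  · right
    change _ ≤ ∑ i ∈ I, -(1 / (64 * B)) * F (D i)
    rw [← Finset.mul_sum, sum_eq, scale]
    linear_combination (I.card : ℝ) * (1 / (64 * B)) * hD

end ExponentialMoment

section RegretMoment

namespace EpisodicMDP

variable {S A : Type} {T : ℕ} [Fintype S] [Fintype A] (M : EpisodicMDP S A T)
  {π : RandPolicy S A T} {t₁ : Fin (T + 1)} {V : Fin (T + 1) → S → ℝ} {g : S → ℝ}

theorem sub_valueFrom_castSucc (π : RandPolicy S A T) (V : Fin (T + 1) → S → ℝ) (g : S → ℝ)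
    {t : Fin T} (ht : t.castSucc < t₁) (s : S) :
    V t.castSucc s - M.valueFrom π t₁ g t.castSucc s =
      expect (π.prob t.castSucc s) fun a => M.loss t₁ V t s a +
        expect (M.P t s a) fun s' => V t.succ s' - M.valueFrom π t₁ g t.succ s' := by
  simp only [loss, if_pos ht, expect_sub, sub_add_sub_cancel]
  rw [expect_const (π.prob_mem_stdSimplex _ s), valueFrom_castSucc _ _ _ ht]

theorem valueFrom_le_of_loss_nonneg (hVg : ∀ t, t₁ ≤ t → V t = g)
    (hloss : ∀ t s a, π.prob t.castSucc s a ≠ 0 → 0 ≤ M.loss t₁ V t s a)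
    (t : Fin (T + 1)) (s : S) : M.valueFrom π t₁ g t s ≤ V t s := by
  induction t using Fin.reverseInduction generalizing s with
  | last => rw [valueFrom_of_le _ _ _ (Fin.le_last t₁), hVg _ (Fin.le_last t₁)]
  | cast t ih =>
    obtain ht | ht := lt_or_ge t.castSucc t₁
    · rw [← sub_nonneg, M.sub_valueFrom_castSucc π V g ht,
        ← expect_const (π.prob_mem_stdSimplex t.castSucc s) 0]
      exact expect_mono_of_ne_zero (π.prob_nonneg _ s) fun a ha => add_nonneg (hloss t s a ha)
        (expect_nonneg (M.P_nonneg t s a) fun s' => sub_nonneg.2 (ih s'))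
    · rw [valueFrom_of_le _ _ _ ht, hVg _ ht]

/-- The function `1 + (θ + 4 θ² B) (V - V^π)` is a supersolution of the dynamic programming
equation for the exponential of the regret, where `V^π` is the value function of `π`. -/
theorem expect_exp_regret_le (hVg : ∀ t, t₁ ≤ t → V t = g)
    (hloss : ∀ t s a, π.prob t.castSucc s a ≠ 0 → 0 ≤ M.loss t₁ V t s a) {l B θ : ℝ}
    (hV : ∀ t s, V t s ∈ Set.Icc l (l + B)) (hB : 0 ≤ B) (hθ : |θ| * B ≤ 1 / 4) :
    expect (M.trajProb π) (fun τ => Real.exp (θ * M.regret t₁ V τ)) ≤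
      1 + (θ + 4 * θ ^ 2 * B) * (expect M.ρ (V 0) - expect (M.stateDist π t₁) g) := by
  have gap_mem (t s) : V t s - M.valueFrom π t₁ g t s ∈ Set.Icc 0 B := by
    have hg (s) : g s ∈ Set.Icc l (l + B) := hVg t₁ le_rfl ▸ hV t₁ s
    exact ⟨sub_nonneg.2 (M.valueFrom_le_of_loss_nonneg hVg hloss t s),
      by linarith [(hV t s).2, (M.valueFrom_mem_Icc π (t₁ := t₁) hg t s).1]⟩
  have exp_regret (τ : Traj S A T) : Real.exp (θ * M.regret t₁ V τ) =
      (∏ t : Fin T, Real.exp (θ * M.loss t₁ V t (τ t.castSucc).1 (τ t.castSucc).2)) * 1 := by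
    rw [regret, Finset.mul_sum, Real.exp_sum, mul_one]
  rw [funext exp_regret]
  refine (M.expect_trajProb_prod_mul_le π (φ := fun t s a => Real.exp (θ * M.loss t₁ V t s a))
    (f := fun _ _ => 1)
    (W := fun t s => 1 + (θ + 4 * θ ^ 2 * B) * (V t s - M.valueFrom π t₁ g t s))
    (fun t s a => (Real.exp_pos _).le) (fun s => ?_) fun t s => ?_).trans_eq ?_
  · rw [expect_const (π.prob_mem_stdSimplex _ s), valueFrom_of_le _ _ _ (Fin.le_last t₁),
      hVg _ (Fin.le_last t₁), sub_self, mul_zero, add_zero]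
  · obtain ht | ht := lt_or_ge t.castSucc t₁
    · rw [M.sub_valueFrom_castSucc π V g ht, ← expect_const_mul]
      refine (expect_mono_of_ne_zero (π.prob_nonneg _ s) fun a ha => ?_).trans_eq
        ((expect_add _ (fun _ => 1) _).trans
          (congrArg (· + _) (expect_const (π.prob_mem_stdSimplex _ s) 1)))
      rw [expect_add, expect_const (M.P_mem_stdSimplex t s a), expect_const_mul]
      refine exp_mul_mul_one_add_le hθ ⟨hloss t s a ha, ?_⟩
        (expect_mem_Icc (M.P_mem_stdSimplex t s a) (gap_mem t.succ))
      linarith [le_of_abs_le (M.abs_loss_le (by linarith) hV t s a (t₁ := t₁))]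
    · have ht' := ht.trans t.castSucc_lt_succ.le
      simp only [loss, if_neg ht.not_gt, valueFrom_of_le _ _ _ ht, valueFrom_of_le _ _ _ ht',
        hVg _ ht, hVg _ ht', sub_self, mul_zero, add_zero, Real.exp_zero, one_mul,
        expect_const (M.P_mem_stdSimplex t s _), expect_const (π.prob_mem_stdSimplex _ s), le_refl]
  · rw [expect_add, expect_const M.ρ_mem_stdSimplex, expect_const_mul, expect_sub,
      ← M.expect_stateDist_valueFrom π g (Fin.zero_le t₁), stateDist_zero]

end EpisodicMDP

end RegretMoment

section Estimator

theorem RandPolicy.Extends.eq_of_prob_ne_zero {S A : Type} {T : ℕ} [Fintype A]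
    {π : RandPolicy S A T} {κ : PartialPolicy S A T} (hπ : π.Extends κ) {t : Fin (T + 1)} {s : S}
    {a b : A} (ha : π.prob t s a ≠ 0) (hb : b ∈ κ t s) : a = b := by
  classical
  rw [eq_pi_single_of_mem_stdSimplex (π.prob_mem_stdSimplex t s) (hπ t s b hb)] at ha
  exact of_not_not fun hab => ha (Pi.single_eq_of_ne hab 1)

/-- The event that the mean of `F` over the samples with index in `I` exceeds `h` or differs from
`p` by more than `w / 4`. -/
def deviationEvent {X ι : Type*} (I : Finset ι) (F : X → ℝ) (h p w : ℝ) : Set (ι → X) :=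
  {D | ¬ (sampleMean I F D ≤ h ∧ |sampleMean I F D - p| ≤ w / 4)}

namespace EpisodicMDP

variable {S A : Type} {T : ℕ} [Fintype S]

/-- An estimator of the expectation of the state function `V t₁ + u` at time `t₁`: the regret is a
control variate. -/
def regretEstimator (M : EpisodicMDP S A T) (t₁ : Fin (T + 1)) (V : Fin (T + 1) → S → ℝ)
    (u : S → ℝ) (τ : Traj S A T) : ℝ :=
  expect M.ρ (V 0) + u (τ t₁).1 - M.regret t₁ V τ

variable (M : EpisodicMDP S A T) {t₁ : Fin (T + 1)} {V : Fin (T + 1) → S → ℝ}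

theorem abs_regret_le {b : ℝ} (hb : 0 ≤ b) (hV : ∀ t s, V t s ∈ Set.Icc (-b) b)
    (τ : Traj S A T) : |M.regret t₁ V τ| ≤ T * (2 * b) := by
  refine (Finset.abs_sum_le_sum_abs _ _).trans ((Finset.sum_le_card_nsmul _ _ (2 * b) fun t _ =>
    (M.abs_loss_le (by linarith) hV t _ _).trans_eq (by ring)).trans_eq ?_)
  rw [Finset.card_univ, Fintype.card_fin, nsmul_eq_mul]

theorem abs_regretEstimator_le {u : S → ℝ} {b : ℝ} (hV : ∀ t s, V t s ∈ Set.Icc (-b) b)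
    (hu : ∀ s, |u s| ≤ b) (τ : Traj S A T) :
    |M.regretEstimator t₁ V u τ| ≤ (T + 1) * (2 * b) := by
  have hb : 0 ≤ b := (abs_nonneg _).trans (hu (τ t₁).1)
  have initial_le := abs_expect_le_of_forall_abs_le M.ρ_mem_stdSimplex fun s => abs_le.2 (hV 0 s)
  calc |M.regretEstimator t₁ V u τ|
      ≤ |expect M.ρ (V 0)| + |u (τ t₁).1| + |M.regret t₁ V τ| :=
        (abs_sub _ _).trans (add_le_add_left (abs_add_le _ _) _)
    _ ≤ b + b + T * (2 * b) := add_le_add_three initial_le (hu _) (M.abs_regret_le hb hV τ)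
    _ = (T + 1) * (2 * b) := by ring

theorem sampleMean_regretEstimator {ι : Type*} {I : Finset ι} (hI : I.Nonempty) (u : S → ℝ)
    (D : ι → Traj S A T) : sampleMean I (M.regretEstimator t₁ V u) D =
      expect M.ρ (V 0) + sampleMean I (fun τ => u (τ t₁).1) D -
        sampleMean I (M.regret t₁ V) D := by
  have card_ne_zero : (I.card : ℝ) ≠ 0 := Nat.cast_ne_zero.2 hI.card_ne_zero
  simp only [sampleMean, regretEstimator, Finset.sum_sub_distrib, Finset.sum_add_distrib,
    Finset.sum_const, nsmul_eq_mul]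
  field_simp

theorem notMem_deviationEvent_regretEstimator {ι : Type*} {I : Finset ι} (hI : I.Nonempty)
    {D : ι → Traj S A T} {U : Set S} {l δ h p q w : ℝ} (hl : 0 ≤ l) (hδ : 0 ≤ δ)
    (hq : q ∈ Set.Icc 0 δ) (hm : expect M.ρ (V 0) ≤ h - l * (33 * δ)) (hw : l * (32 * δ) ≤ w)
    (hregret : 0 ≤ sampleMean I (M.regret t₁ V) D)
    (hregret' : |sampleMean I (M.regret t₁ V) D - (expect M.ρ (V 0) - (p - l * q))| < w / 8)
    (hvisits : sampleMean I (fun τ : Traj S A T => U.indicator 1 (τ t₁).1) D ∈ Set.Ico 0 (4 * δ)) :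
    D ∉ deviationEvent I (M.regretEstimator t₁ V fun s => l * U.indicator 1 s) h p w := by
  have penalty_mean : sampleMean I (fun τ : Traj S A T => l * U.indicator 1 (τ t₁).1) D =
      l * sampleMean I (fun τ : Traj S A T => U.indicator 1 (τ t₁).1) D := by
    simp only [sampleMean, ← Finset.mul_sum, mul_div_assoc]
  obtain ⟨hlower, hupper⟩ := abs_lt.1 hregret'
  have hlδ := mul_nonneg hl hδ
  have hlq := mul_le_mul_of_nonneg_left hq.2 hl
  have hlq' := mul_nonneg hl hq.1
  have hlY := mul_le_mul_of_nonneg_left hvisits.2.le hl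
  have hlY' := mul_nonneg hl hvisits.1
  refine not_not.2 ?_
  rw [M.sampleMean_regretEstimator hI, penalty_mean]
  exact ⟨by linarith, abs_le.2 ⟨by linarith, by linarith⟩⟩

variable [Fintype A]

theorem expect_regretEstimator (π : RandPolicy S A T) (u : S → ℝ) :
    expect (M.trajProb π) (M.regretEstimator t₁ V u) =
      expect (M.stateDist π t₁) fun s => V t₁ s + u s := by
  calc expect (M.trajProb π) (M.regretEstimator t₁ V u)
      = expect (M.trajProb π) (fun τ => expect M.ρ (V 0) + u (τ t₁).1) -
          expect (M.trajProb π) (M.regret t₁ V) := expect_sub _ _ _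
    _ = expect (M.stateDist π t₁) fun s => V t₁ s + u s := by
        rw [M.expect_regret, expect_add, expect_add, expect_const (M.trajProb_mem_stdSimplex π),
          M.expect_trajProb_state]
        ring

variable {π : RandPolicy S A T}

theorem regret_nonneg (hloss : ∀ t s a, π.prob t.castSucc s a ≠ 0 → 0 ≤ M.loss t₁ V t s a)
    {τ : Traj S A T} (hτ : M.trajProb π τ ≠ 0) : 0 ≤ M.regret t₁ V τ :=
  Finset.sum_nonneg fun t _ => hloss t _ _ <|
    Finset.prod_ne_zero_iff.1 (right_ne_zero_of_mul hτ) t.castSucc (Finset.mem_univ _)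

theorem expect_stateDist_le_of_loss_nonneg
    (hloss : ∀ t s a, π.prob t.castSucc s a ≠ 0 → 0 ≤ M.loss t₁ V t s a) :
    expect (M.stateDist π t₁) (V t₁) ≤ expect M.ρ (V 0) := by
  have hτ := M.trajProb_mem_stdSimplex π
  rw [← sub_nonneg, ← M.expect_regret π t₁ V, ← expect_const hτ 0]
  exact expect_mono_of_ne_zero hτ.1 fun τ => M.regret_nonneg hloss

theorem prob_deviationEvent_regretEstimator_le {ι : Type*} [Fintype ι] [DecidableEq ι]
    {f : S → ℝ} {U : Set S} {l δ h w : ℝ}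
    (hVf : ∀ t, t₁ ≤ t → V t = fun s => f s - l * U.indicator 1 s)
    (hV : ∀ t s, V t s ∈ Set.Icc (-(1 + l)) (1 + l))
    (hloss : ∀ t s a, π.prob t.castSucc s a ≠ 0 → 0 ≤ M.loss t₁ V t s a) (hl : 0 ≤ l)
    (hδ : 0 < δ) (hU : prob (M.stateDist π t₁) U ≤ δ) (hm : expect M.ρ (V 0) ≤ h - l * (33 * δ))
    (hδw : δ ≤ w) (hw : h - expect (M.stateDist π t₁) f ≤ w) {I : Finset ι} (hI : I.Nonempty) :
    prob (iidMass (M.trajProb π)) (deviationEvent I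
        (M.regretEstimator t₁ V fun s => l * U.indicator 1 s) h
        (expect (M.stateDist π t₁) f) w) ≤
      3 * Real.exp (-(I.card * (δ / 3072))) := by
  set p := expect (M.stateDist π t₁) f
  set q := prob (M.stateDist π t₁) U
  have hτ := M.trajProb_mem_stdSimplex π
  have hq : q ∈ Set.Icc 0 δ := ⟨prob_nonneg (M.stateDist_mem_stdSimplex π t₁).1 U, hU⟩
  have expect_target : expect (M.stateDist π t₁) (fun s => f s - l * U.indicator 1 s) =
      p - l * q := by rw [expect_sub, expect_const_mul, ← prob]
  have value_le : p - l * q ≤ expect M.ρ (V 0) := by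
    rw [← expect_target, ← hVf t₁ le_rfl]
    exact M.expect_stateDist_le_of_loss_nonneg hloss
  have hlq := mul_le_mul_of_nonneg_left hq.2 hl
  have hlq' := mul_nonneg hl hq.1
  have penalty_le : l * (32 * δ) ≤ w := by linarith
  have regret_tail := prob_le_abs_sampleMean_sub_le_exp hτ (F := M.regret t₁ V)
    (R := expect M.ρ (V 0) - (p - l * q)) (B := 2 * (1 + l)) (w := w) (by positivity)
    (fun θ hθ => expect_target ▸ M.expect_exp_regret_le hVf hloss
      (fun t s => ⟨(hV t s).1, (hV t s).2.trans_eq (by ring)⟩) (by positivity) hθ)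
    (by linarith) hI
  have visits_tail := prob_le_sampleMean_le_exp hτ hI
    (F := fun τ : Traj S A T => U.indicator 1 (τ t₁).1)
    (fun τ => indicator_one_mem_Icc U _) ((M.expect_trajProb_state π t₁ _).trans_le hU)
  have exp_le {x : ℝ} (hx : δ / 3072 ≤ x) :
      Real.exp (-(I.card * x)) ≤ Real.exp (-(I.card * (δ / 3072))) :=
    Real.exp_le_exp.2 (neg_le_neg (mul_le_mul_of_nonneg_left hx (Nat.cast_nonneg _)))
  have rate_le : δ / 3072 ≤ w / (1024 * (2 * (1 + l))) := by
    rw [div_le_div_iff₀ (by norm_num) (by positivity)]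
    linarith
  have hD := (iidMass_mem_stdSimplex (ι := ι) hτ).1
  refine (prob_mono_of_ne_zero hD fun D hD' hdev => ?_).trans ((prob_union_le hD _ _).trans
    ((add_le_add (regret_tail.trans (mul_le_mul_of_nonneg_left (exp_le rate_le) zero_le_two))
      (visits_tail.trans (exp_le (by linarith)))).trans_eq (by ring)))
  by_contra hgood
  simp only [Set.mem_union, not_or] at hgood
  exact M.notMem_deviationEvent_regretEstimator hI hl hδ.le hq hm penalty_le
    (sampleMean_nonneg fun i _ => M.regret_nonneg hloss (ne_zero_of_iidMass_ne_zero hD' i))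
    (not_le.1 hgood.1) ⟨sampleMean_nonneg fun i _ => indicator_one_nonneg U _, not_le.1 hgood.2⟩
    hdev

/-- The function `F` of a trajectory estimates the expectation of `f` at time `t₁`. If the policy
extends `κ` and visits `U` at time `t₁` with probability at most `δ`, then the mean of independent
copies exceeds `h` with exponentially small probability only, and its error is of the order of the
distance from the expectation to `h`. -/
structure IsUpperEstimator (M : EpisodicMDP S A T) (κ : PartialPolicy S A T) (t₁ : Fin (T + 1))
    (f : S → ℝ) (U : Set S) (δ h : ℝ) (F : Traj S A T → ℝ) : Prop where
  abs_le : ∀ τ, |F τ| ≤ (T + 1) * (2 + 1 / δ)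
  expect_eq : ∀ π, expect (M.trajProb π) F = expect (M.stateDist π t₁) f
  prob_deviation_le : ∀ π : RandPolicy S A T, π.Extends κ → prob (M.stateDist π t₁) U ≤ δ →
    ∀ w, δ ≤ w → h - expect (M.stateDist π t₁) f ≤ w →
    ∀ {ι : Type} [Fintype ι] [DecidableEq ι] {I : Finset ι}, I.Nonempty →
      prob (iidMass (M.trajProb π)) (deviationEvent I F h (expect (M.stateDist π t₁) f) w) ≤
        3 * Real.exp (-(I.card * (δ / 3072)))

theorem exists_penalty {κ : PartialPolicy S A T} {f : S → ℝ} (hf : ∀ s, |f s| ≤ 1) {U : Set S}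
    {δ h : ℝ} (hδ : 0 < δ) (hne : ∃ d ∈ M.attainable κ t₁, prob d U ≤ δ)
    (hh : ∀ d ∈ M.attainable κ t₁, prob d U ≤ 33 * δ → expect d f ≤ h) (hh' : h ≤ 1) :
    ∃ l, 0 ≤ l ∧ 2 * l ≤ 1 / δ ∧
      ∀ d ∈ M.attainable κ t₁, expect d f - l * prob d U ≤ h - l * (33 * δ) := by
  obtain ⟨d₀, hd₀, hU₀⟩ := hne
  obtain ⟨l, hl, hpenalty⟩ := exists_lagrange_multiplier (c := 33 * δ) (h := h)
    ((M.convex_attainable κ t₁).linear_image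
      (((isLinearMap_expect f).mk' _).prod ((isLinearMap_expect (U.indicator 1)).mk' _)))
    ⟨_, ⟨d₀, hd₀, rfl⟩, hU₀.trans_lt (by linarith)⟩
    (by rintro _ ⟨d, hd, rfl⟩; exact hh d hd)
  have penalty_le (d) (hd : d ∈ M.attainable κ t₁) :
      expect d f - l * prob d U ≤ h - l * (33 * δ) := hpenalty _ ⟨d, hd, rfl⟩
  have penalty_d₀ := penalty_le d₀ hd₀
  refine ⟨l, hl, ?_, penalty_le⟩
  obtain ⟨π, -, rfl⟩ := hd₀
  have value_ge := le_expect_of_forall_le (M.stateDist_mem_stdSimplex π t₁)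
    fun s => (abs_le.1 (hf s)).1
  rw [le_div_iff₀ hδ]
  linarith [mul_le_mul_of_nonneg_left hU₀ hl]

theorem exists_isUpperEstimator [Nonempty A] {κ : PartialPolicy S A T} {f : S → ℝ}
    (hf : ∀ s, |f s| ≤ 1) {U : Set S} {δ h : ℝ} (hδ : 0 < δ)
    (hne : ∃ d ∈ M.attainable κ t₁, prob d U ≤ δ)
    (hh : ∀ d ∈ M.attainable κ t₁, prob d U ≤ 33 * δ → expect d f ≤ h) (hh' : h ≤ 1) :
    ∃ F, M.IsUpperEstimator κ t₁ f U δ h F := by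
  classical
  obtain ⟨l, hl, hlδ, hpenalty⟩ := M.exists_penalty hf hδ hne hh hh'
  obtain ⟨σ, hσ, hloss⟩ := M.exists_extends_forall_loss_nonneg κ t₁
    fun s => f s - l * U.indicator 1 s
  set V := M.valueFrom σ.toRand t₁ fun s => f s - l * U.indicator 1 s
  have hVf (t) (ht : t₁ ≤ t) : V t = fun s => f s - l * U.indicator 1 s :=
    M.valueFrom_of_le σ.toRand _ ht
  have penalty_mem (s : S) : l * U.indicator 1 s ∈ Set.Icc 0 l :=
    ⟨mul_nonneg hl (indicator_one_nonneg U s),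
      mul_le_of_le_one_right hl (indicator_one_mem_Icc U s).2⟩
  have hV (t s) : V t s ∈ Set.Icc (-(1 + l)) (1 + l) := by
    refine M.valueFrom_mem_Icc _ (fun s => ⟨?_, ?_⟩) t s <;>
      linarith [(abs_le.1 (hf s)).1, (abs_le.1 (hf s)).2, (penalty_mem s).1, (penalty_mem s).2]
  refine ⟨M.regretEstimator t₁ V fun s => l * U.indicator 1 s, fun τ => ?_, fun π => ?_,
    fun π hπ hU w hδw hw _ _ _ I hI => M.prob_deviationEvent_regretEstimator_le hVf hV
      (fun t s a ha => hloss t s a fun b hb => hπ.eq_of_prob_ne_zero ha hb) hl hδ hU ?_ hδw hw hI⟩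
  · refine (M.abs_regretEstimator_le hV (fun s => ?_) τ).trans ?_
    · rw [abs_of_nonneg (penalty_mem s).1]
      linarith [(penalty_mem s).2]
    · gcongr
      linarith
  · simp only [M.expect_regretEstimator, hVf t₁ le_rfl, sub_add_cancel]
  · have initial := M.expect_stateDist_valueFrom σ.toRand (fun s => f s - l * U.indicator 1 s)
      (Fin.zero_le t₁)
    rw [stateDist_zero, expect_sub, expect_const_mul] at initial
    exact initial.trans_le (hpenalty _ ⟨_, hσ.toRand, rfl⟩)

end EpisodicMDP
end Estimator

section SplitMean

variable {X ι : Type*} {Ia Ib : Finset ι} {F G : X → ℝ} {m h h' p : ℝ} {D : ι → X}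

/-- The samples in `Ia` decide whether the samples in `Ib` are averaged over `F` or over `-G`. For
equal expectations of `F` and `-G` this choice does not affect the expectation of the result. -/
def splitMean (Ia Ib : Finset ι) (F G : X → ℝ) (m : ℝ) (D : ι → X) : ℝ :=
  if m ≤ sampleMean Ia F D then sampleMean Ib F D else -sampleMean Ib G D

theorem dependsOn_splitMean [DecidableEq ι] (Ia Ib : Finset ι) (F G : X → ℝ) (m : ℝ) :
    DependsOn (splitMean Ia Ib F G m) (↑(Ia ∪ Ib) : Set ι) := fun D D' hD => by
  have agree_left (i) (hi : i ∈ Ia) : D i = D' i := hD i (Finset.mem_union_left _ hi)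
  have agree_right (i) (hi : i ∈ Ib) : D i = D' i := hD i (Finset.mem_union_right _ hi)
  simp only [splitMean, dependsOn_sampleMean Ia F agree_left, dependsOn_sampleMean Ib F agree_right,
    dependsOn_sampleMean Ib G agree_right]

theorem abs_splitMean_le (hIb : Ib.Nonempty) {B : ℝ} (hF : ∀ x, |F x| ≤ B)
    (hG : ∀ x, |G x| ≤ B) (m : ℝ) (D : ι → X) : |splitMean Ia Ib F G m D| ≤ B := by
  rw [splitMean]
  split_ifs
  · exact abs_sampleMean_le hIb fun i _ => hF (D i)
  · rw [abs_neg]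
    exact abs_sampleMean_le hIb fun i _ => hG (D i)

theorem splitMean_mem_Icc (hIaF : D ∉ deviationEvent Ia F h p (h - h'))
    (hIbF : D ∉ deviationEvent Ib F h p (h - h'))
    (hIbG : D ∉ deviationEvent Ib G (-h') (-p) (h - h')) :
    splitMean Ia Ib F G ((h' + h) / 2) D ∈ Set.Icc h' h := by
  obtain ⟨-, ha⟩ := not_not.1 hIaF
  obtain ⟨hbF, hb⟩ := not_not.1 hIbF
  obtain ⟨hbG, hc⟩ := not_not.1 hIbG
  rw [abs_le] at ha hb hc
  rw [splitMean]
  split_ifs with hm <;> constructor <;> linarith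

theorem expect_splitMean [Fintype X] [Fintype ι] [DecidableEq ι] {w : X → ℝ}
    (hw : w ∈ stdSimplex ℝ X) (hab : Disjoint Ia Ib) (hIb : Ib.Nonempty) (hF : expect w F = p)
    (hG : expect w G = -p) (m : ℝ) : expect (iidMass w) (splitMean Ia Ib F G m) = p := by
  have neg_mean (D : ι → X) : -sampleMean Ib G D = sampleMean Ib (fun x => -G x) D := by
    simp only [sampleMean, Finset.sum_neg_distrib, neg_div]
  rw [← expect_ite_sampleMean hw hIb hab (E := {D | m ≤ sampleMean Ia F D})
    (fun D D' hD => congrArg (m ≤ ·) (dependsOn_sampleMean Ia F hD)) hF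
    (show expect w (fun x => -G x) = p by rw [expect_neg, hG, neg_neg])]
  simp only [funext fun D => splitMean.eq_def Ia Ib F G m D, neg_mean, Set.mem_ofPred_eq]

end SplitMean

section Matching

/-- The contribution to the bias of the event that one of three sample means of size `n` deviates
from its expectation. -/
def deviationBias (T : ℕ) (n δ : ℝ) : ℝ :=
  9 * (1 + (T + 1) * (2 + 1 / δ)) * Real.exp (-(n * (δ / 3072)))

theorem deviationBias_nonneg (T : ℕ) (n : ℝ) {δ : ℝ} (hδ : 0 ≤ δ) : 0 ≤ deviationBias T n δ := by
  unfold deviationBias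
  positivity

namespace EpisodicMDP

variable {S A : Type} {T : ℕ} [Fintype S] [Fintype A] (M : EpisodicMDP S A T)
  {κ : PartialPolicy S A T} {t₁ : Fin (T + 1)} {f : S → ℝ} {U : Set S}

/-- The expectations of `f` at time `t₁` under the policies which extend `κ` and visit `U` at time
`t₁` with probability at most `b`. -/
def attainableMeans (M : EpisodicMDP S A T) (κ : PartialPolicy S A T) (t₁ : Fin (T + 1))
    (f : S → ℝ) (U : Set S) (b : ℝ) : Set ℝ :=
  (expect · f) '' (M.attainable κ t₁ ∩ {d | prob d U ≤ b})

theorem convex_attainableMeans (κ : PartialPolicy S A T) (t₁ : Fin (T + 1)) (f : S → ℝ)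
    (U : Set S) (b : ℝ) : Convex ℝ (M.attainableMeans κ t₁ f U b) :=
  ((M.convex_attainable κ t₁).inter
    (convex_halfSpace_le (isLinearMap_expect _) b)).is_linear_image (isLinearMap_expect f)

theorem attainableMeans_subset_Icc (hf : ∀ s, |f s| ≤ 1) (b : ℝ) :
    M.attainableMeans κ t₁ f U b ⊆ Set.Icc (-1) 1 := by
  rintro _ ⟨_, ⟨⟨π, -, rfl⟩, -⟩, rfl⟩
  exact expect_mem_Icc (M.stateDist_mem_stdSimplex π t₁) fun s => abs_le.1 (hf s)

theorem exists_extends_abs_expect_sub_le {b ε : ℝ}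
    (hne : (M.attainableMeans κ t₁ f U b).Nonempty) (hε : 0 < ε) (v : ℝ) :
    ∃ π : RandPolicy S A T, π.Extends κ ∧ prob (M.stateDist π t₁) U ≤ b ∧
      (v ∈ Set.Icc (sInf (M.attainableMeans κ t₁ f U b)) (sSup (M.attainableMeans κ t₁ f U b)) →
        |expect (M.stateDist π t₁) f - v| ≤ ε) := by
  by_cases hv : v ∈ Set.Icc (sInf (M.attainableMeans κ t₁ f U b))
    (sSup (M.attainableMeans κ t₁ f U b))
  · obtain ⟨_, ⟨_, ⟨⟨π, hπ, rfl⟩, hU⟩, rfl⟩, hπv⟩ :=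
      exists_mem_abs_sub_le (M.convex_attainableMeans κ t₁ f U b) hne hv hε
    exact ⟨π, hπ, hU, fun _ => hπv⟩
  · obtain ⟨_, _, ⟨⟨π, hπ, rfl⟩, hU⟩, -⟩ := hne
    exact ⟨π, hπ, hU, fun h => absurd h hv⟩

theorem attainableMeans_subset_Icc_sInf_sSup (hf : ∀ s, |f s| ≤ 1) (b : ℝ) :
    M.attainableMeans κ t₁ f U b ⊆
      Set.Icc (sInf (M.attainableMeans κ t₁ f U b)) (sSup (M.attainableMeans κ t₁ f U b)) :=
  fun _ hx => ⟨csInf_le (bddBelow_Icc.mono (M.attainableMeans_subset_Icc hf b)) hx,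
    le_csSup (bddAbove_Icc.mono (M.attainableMeans_subset_Icc hf b)) hx⟩

theorem exists_isUpperEstimator_sSup_and_neg_sInf [Nonempty A] (hf : ∀ s, |f s| ≤ 1) {δ : ℝ}
    (hδ : 0 < δ) (hne : ∃ d ∈ M.attainable κ t₁, prob d U ≤ δ) :
    (∃ F, M.IsUpperEstimator κ t₁ f U δ (sSup (M.attainableMeans κ t₁ f U (33 * δ))) F) ∧
      ∃ G, M.IsUpperEstimator κ t₁ (fun s => -f s) U δ
        (-sInf (M.attainableMeans κ t₁ f U (33 * δ))) G := by
  have subset_Icc := M.attainableMeans_subset_Icc (κ := κ) (t₁ := t₁) (U := U) hf (33 * δ)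
  have mem_Icc {d : S → ℝ} (hd : d ∈ M.attainable κ t₁) (hdU : prob d U ≤ 33 * δ) :=
    M.attainableMeans_subset_Icc_sInf_sSup hf (33 * δ) ⟨d, ⟨hd, hdU⟩, rfl⟩
  have nonempty : (M.attainableMeans κ t₁ f U (33 * δ)).Nonempty := by
    obtain ⟨d, hd, hdU⟩ := hne
    exact ⟨_, d, ⟨hd, show prob d U ≤ 33 * δ by linarith⟩, rfl⟩
  exact ⟨M.exists_isUpperEstimator hf hδ hne (fun d hd hdU => (mem_Icc hd hdU).2)
      (csSup_le nonempty fun x hx => (subset_Icc hx).2),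
    M.exists_isUpperEstimator (fun s => (abs_neg (f s)).trans_le (hf s)) hδ hne
      (fun d hd hdU => (expect_neg d f).trans_le (neg_le_neg (mem_Icc hd hdU).1))
      (neg_le.1 (le_csInf nonempty fun x hx => (subset_Icc hx).1))⟩

variable {M} {ι : Type} [Fintype ι] [DecidableEq ι] {Ia Ib : Finset ι} {n δ h h' : ℝ}
  {F G : Traj S A T → ℝ} {π : RandPolicy S A T}

theorem prob_deviationEvent_union_le (hF : M.IsUpperEstimator κ t₁ f U δ h F)
    (hG : M.IsUpperEstimator κ t₁ (fun s => -f s) U δ (-h') G) (hδ : 0 ≤ δ) (hw : δ ≤ h - h')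
    (hπ : π.Extends κ) (hπU : prob (M.stateDist π t₁) U ≤ δ)
    (hp : expect (M.stateDist π t₁) f ∈ Set.Icc h' h) (hIa : Ia.Nonempty) (hIb : Ib.Nonempty)
    (ha : n ≤ Ia.card) (hb : n ≤ Ib.card) :
    prob (iidMass (M.trajProb π))
      (deviationEvent Ia F h (expect (M.stateDist π t₁) f) (h - h') ∪
        deviationEvent Ib F h (expect (M.stateDist π t₁) f) (h - h') ∪
        deviationEvent Ib G (-h') (-expect (M.stateDist π t₁) f) (h - h')) ≤
      9 * Real.exp (-(n * (δ / 3072))) := by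
  have hD := (iidMass_mem_stdSimplex (ι := ι) (M.trajProb_mem_stdSimplex π)).1
  have exp_le {I : Finset ι} (hI : n ≤ I.card) :
      3 * Real.exp (-(I.card * (δ / 3072))) ≤ 3 * Real.exp (-(n * (δ / 3072))) := by
    gcongr
  have tailF {I : Finset ι} (hI : I.Nonempty) :=
    hF.prob_deviation_le π hπ hπU (h - h') hw (by linarith [hp.1]) hI
  have tailG := hG.prob_deviation_le π hπ hπU (h - h') hw
    (by rw [expect_neg]; linarith [hp.2]) hIb
  rw [expect_neg] at tailG
  exact (prob_union_le hD _ _).trans <| (add_le_add ((prob_union_le hD _ _).trans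
    (add_le_add ((tailF hIa).trans (exp_le ha)) ((tailF hIb).trans (exp_le hb))))
    (tailG.trans (exp_le hb))).trans_eq (by ring)

theorem abs_expect_splitMean_policy_sub_le (hF : M.IsUpperEstimator κ t₁ f U δ h F)
    (hG : M.IsUpperEstimator κ t₁ (fun s => -f s) U δ (-h') G) (hf : ∀ s, |f s| ≤ 1) (hδ : 0 < δ)
    (hw : δ ≤ h - h') (hπ : π.Extends κ) (hπU : prob (M.stateDist π t₁) U ≤ δ)
    (hp : expect (M.stateDist π t₁) f ∈ Set.Icc h' h) (hab : Disjoint Ia Ib)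
    (hIa : Ia.Nonempty) (hIb : Ib.Nonempty) (ha : n ≤ Ia.card) (hb : n ≤ Ib.card)
    {σ : ℝ → RandPolicy S A T}
    (hσ : ∀ v ∈ Set.Icc h' h, |expect (M.stateDist (σ v) t₁) f - v| ≤ δ) :
    |expect (iidMass (M.trajProb π))
        (fun D => expect (M.stateDist (σ (splitMean Ia Ib F G ((h' + h) / 2) D)) t₁) f) -
      expect (M.stateDist π t₁) f| ≤ δ + deviationBias T n δ := by
  have hτ := M.trajProb_mem_stdSimplex π
  have hD := iidMass_mem_stdSimplex (ι := ι) hτ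
  have unbiased := expect_splitMean hτ hab hIb (hF.expect_eq π)
    ((hG.expect_eq π).trans (expect_neg _ _)) ((h' + h) / 2)
  rw [← unbiased, ← expect_sub]
  refine (abs_expect_le hD.1).trans ((expect_le_add_mul_prob hD
    (K := 1 + (T + 1) * (2 + 1 / δ)) (a := δ)
    (s := deviationEvent Ia F h (expect (M.stateDist π t₁) f) (h - h') ∪
      deviationEvent Ib F h (expect (M.stateDist π t₁) f) (h - h') ∪
      deviationEvent Ib G (-h') (-expect (M.stateDist π t₁) f) (h - h'))
    (fun D _ hgood => ?_) fun D => ?_).trans ?_)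
  · simp only [Set.mem_union, not_or] at hgood
    exact hσ _ (splitMean_mem_Icc hgood.1.1 hgood.1.2 hgood.2)
  · have mean_le := abs_expect_le_of_forall_abs_le
      (M.stateDist_mem_stdSimplex (σ (splitMean Ia Ib F G ((h' + h) / 2) D)) t₁) hf
    have target_le := abs_splitMean_le (Ia := Ia) hIb hF.abs_le hG.abs_le ((h' + h) / 2) D
    exact (abs_sub _ _).trans ((add_le_add mean_le target_le).trans (le_add_of_nonneg_left hδ.le))
  · have tail := prob_deviationEvent_union_le hF hG hδ.le hw hπ hπU hp hIa hIb ha hb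
    refine add_le_add_right ((mul_le_mul_of_nonneg_left tail (by positivity)).trans_eq ?_) δ
    rw [deviationBias]
    ring

theorem exists_matching [Nonempty A] (M : EpisodicMDP S A T) (κ : PartialPolicy S A T)
    (t₁ : Fin (T + 1)) (hf : ∀ s, |f s| ≤ 1) (U : Set S) (hδ : 0 < δ) (hab : Disjoint Ia Ib)
    (hIa : Ia.Nonempty) (hIb : Ib.Nonempty) (ha : n ≤ Ia.card) (hb : n ≤ Ib.card) :
    ∃ e : (ι → Traj S A T) → RandPolicy S A T, (∀ D, (e D).Extends κ) ∧
      DependsOn e (↑(Ia ∪ Ib) : Set ι) ∧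
      ∀ π : RandPolicy S A T, π.Extends κ → prob (M.stateDist π t₁) U ≤ δ →
        (∀ D, prob (M.stateDist (e D) t₁) U ≤ 33 * δ) ∧
        |expect (iidMass (M.trajProb π)) (fun D => expect (M.stateDist (e D) t₁) f) -
          expect (M.stateDist π t₁) f| ≤ δ + deviationBias T n δ := by
  by_cases hne : ∃ π : RandPolicy S A T, π.Extends κ ∧ prob (M.stateDist π t₁) U ≤ δ
  swap
  · classical
    obtain ⟨π₀, hπ₀⟩ := DetPolicy.exists_extends κ
    exact ⟨fun _ => π₀.toRand, fun _ => hπ₀.toRand, fun _ _ _ => rfl,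
      fun π hπ hπU => absurd ⟨π, hπ, hπU⟩ hne⟩
  obtain ⟨π₀, hπ₀, hU₀⟩ := hne
  set K := M.attainableMeans κ t₁ f U (33 * δ)
  have mem_K {π : RandPolicy S A T} (hπ : π.Extends κ) (hπU : prob (M.stateDist π t₁) U ≤ δ) :
      expect (M.stateDist π t₁) f ∈ K :=
    ⟨_, ⟨⟨π, hπ, rfl⟩, show prob (M.stateDist π t₁) U ≤ 33 * δ by linarith⟩, rfl⟩
  have mem_Icc {x : ℝ} (hx : x ∈ K) : x ∈ Set.Icc (sInf K) (sSup K) :=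
    M.attainableMeans_subset_Icc_sInf_sSup hf (33 * δ) hx
  obtain hw | hw := lt_or_ge (sSup K - sInf K) δ
  · refine ⟨fun _ => π₀, fun _ => hπ₀, fun _ _ _ => rfl, fun π hπ hπU =>
      ⟨fun _ => by linarith, ?_⟩⟩
    have h₀ := mem_Icc (mem_K hπ₀ hU₀)
    have hp := mem_Icc (mem_K hπ hπU)
    rw [expect_const (iidMass_mem_stdSimplex (M.trajProb_mem_stdSimplex π))]
    exact le_add_of_le_of_nonneg ((abs_sub_le_of_le_of_le h₀.1 h₀.2 hp.1 hp.2).trans hw.le)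
      (deviationBias_nonneg T n hδ.le)
  obtain ⟨⟨F, hF⟩, G, hG⟩ :=
    M.exists_isUpperEstimator_sSup_and_neg_sInf hf hδ ⟨_, ⟨π₀, hπ₀, rfl⟩, hU₀⟩
  choose σ hσ hσU hσv using M.exists_extends_abs_expect_sub_le ⟨_, mem_K hπ₀ hU₀⟩ hδ
  exact ⟨fun D => σ (splitMean Ia Ib F G ((sInf K + sSup K) / 2) D), fun _ => hσ _,
    fun D D' hD => congrArg σ (dependsOn_splitMean Ia Ib F G _ hD), fun π hπ hπU =>
    ⟨fun _ => hσU _, abs_expect_splitMean_policy_sub_le hF hG hf hδ hw hπ hπU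
      (mem_Icc (mem_K hπ hπU)) hab hIa hIb ha hb hσv⟩⟩

end EpisodicMDP
end Matching

section TerminalError

variable {S A : Type} {T : ℕ} [Fintype A] {κ : PartialPolicy S A T}

theorem RandPolicy.Extends.eq_of_forall_ne_none {π π' : RandPolicy S A T} (hπ : π.Extends κ)
    (hπ' : π'.Extends κ) (hκ : ∀ t s, κ t s ≠ none) : π = π' := by
  have prob_eq : π.prob = π'.prob :=
    funext fun t => funext fun s => hπ.prob_congr hπ' (hκ t s)
  cases π
  cases π'
  congr

namespace EpisodicMDP

variable [Fintype S] (M : EpisodicMDP S A T)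

theorem abs_expect_terminalValue_sub_le {X : Type*} [Fintype X] {w : X → ℝ}
    (hw : w ∈ stdSimplex ℝ X) {t₁ : Fin (T + 1)} (hlater : ∀ t s, t₁ < t → κ t s ≠ none) {c : S}
    (hc : ({c}ᶜ ∩ {s | κ t₁ s = none}ᶜ).Subsingleton) {π : RandPolicy S A T} (hπ : π.Extends κ)
    {e : X → RandPolicy S A T} (he : ∀ x, (e x).Extends κ) {η δ ε : ℝ}
    (hη : |expect w (fun x => M.stateDist (e x) t₁ c) - M.stateDist π t₁ c| ≤ η)
    (hδ : prob (M.stateDist π t₁) {s | κ t₁ s = none} ≤ δ)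
    (hε : ∀ x, prob (M.stateDist (e x) t₁) {s | κ t₁ s = none} ≤ ε)
    {r : S → A → ℝ} (hr : ∀ s a, r s a ∈ Set.Icc 0 1) :
    |expect w (fun x => M.terminalValue (e x) r) - M.terminalValue π r| ≤ η + 2 * ε + δ := by
  set m : S → ℝ := fun s => expect w fun x => M.stateDist (e x) t₁ s
  set v := M.terminalValueFrom π r t₁
  have value_sub_le :
      |expect w (fun x => M.terminalValue (e x) r) - expect m v| ≤ ε := by
    rw [expect_expect, ← expect_sub]
    exact abs_expect_le_of_forall_abs_le hw fun x =>
      (M.abs_terminalValue_sub_le (he x) hπ hr fun t s => hlater t s).trans (hε x)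
  have test_sub_le := abs_expect_sub_expect_le
    (expect_mem_stdSimplex hw fun x => M.stateDist_mem_stdSimplex (e x) t₁)
    (M.stateDist_mem_stdSimplex π t₁) (M.terminalValueFrom_mem_Icc π hr t₁) hc
  have prob_le : prob m {s | κ t₁ s = none} ≤ ε := by
    rw [prob, expect_expect]
    exact expect_le_of_forall_le hw hε
  rw [M.expect_stateDist_terminalValueFrom π r t₁] at test_sub_le
  linarith [abs_sub_le (expect w fun x => M.terminalValue (e x) r) (expect m v)
    (M.terminalValue π r)]

variable {ι : Type} [Fintype ι] [DecidableEq ι] {Ia Ib : Finset ι} {n δ : ℝ}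

theorem exists_matching_terminalValue [Nonempty A] (κ : PartialPolicy S A T)
    (hS : Fintype.card S ≤ 3) (hδ : 0 < δ) (hab : Disjoint Ia Ib) (hIa : Ia.Nonempty)
    (hIb : Ib.Nonempty) (ha : n ≤ Ia.card) (hb : n ≤ Ib.card) :
    ∃ e : (ι → Traj S A T) → RandPolicy S A T, (∀ D, (e D).Extends κ) ∧
      DependsOn e (↑(Ia ∪ Ib) : Set ι) ∧
      ∀ π : RandPolicy S A T, π.Extends κ → (∀ t s, κ t s = none → M.stateDist π t s ≤ δ) →
        ∀ r : S → A → ℝ, (∀ s a, r s a ∈ Set.Icc 0 1) →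
          |expect (iidMass (M.trajProb π)) (fun D => M.terminalValue (e D) r) -
            M.terminalValue π r| ≤ 204 * δ + deviationBias T n (3 * δ) := by
  by_cases hκ : ∀ t s, κ t s ≠ none
  · classical
    obtain ⟨π₀, hπ₀⟩ := DetPolicy.exists_extends κ
    refine ⟨fun _ => π₀.toRand, fun _ => hπ₀.toRand, fun _ _ _ => rfl, fun π hπ _ r _ => ?_⟩
    rw [hπ.eq_of_forall_ne_none hπ₀.toRand hκ,
      expect_const (iidMass_mem_stdSimplex (M.trajProb_mem_stdSimplex _)), sub_self, abs_zero]
    exact add_nonneg (by positivity) (deviationBias_nonneg T n (by positivity))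
  push Not at hκ
  obtain ⟨t₁, ⟨s₁, hs₁⟩, ht₁⟩ := (Set.toFinite {t | ∃ s, κ t s = none}).exists_maximal hκ
  have hlater (t s) (ht : t₁ < t) : κ t s ≠ none := fun hs => ht.not_ge (ht₁ ⟨s, hs⟩ ht.le)
  obtain ⟨c, hc⟩ := exists_subsingleton_compl_inter hS (U := {s | κ t₁ s = none}) ⟨s₁, hs₁⟩
  obtain ⟨e, he, hdep, hmatch⟩ := M.exists_matching κ t₁ (f := ({c} : Set S).indicator 1)
    (fun s => abs_le.2 ⟨by linarith [indicator_one_nonneg {c} s], (indicator_one_mem_Icc {c} s).2⟩)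
    {s | κ t₁ s = none} (show 0 < 3 * δ by positivity) hab hIa hIb ha hb
  refine ⟨e, he, hdep, fun π hπ hsmall r hr => ?_⟩
  have prob_le : prob (M.stateDist π t₁) {s | κ t₁ s = none} ≤ 3 * δ :=
    (prob_le_card_mul hδ.le (hsmall t₁)).trans
      (mul_le_mul_of_nonneg_right (by exact_mod_cast hS) hδ.le)
  obtain ⟨prob_le', expect_sub_le⟩ := hmatch π hπ prob_le
  change |expect _ (fun D => prob (M.stateDist (e D) t₁) {c}) - prob (M.stateDist π t₁) {c}| ≤ _
    at expect_sub_le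
  simp only [prob_singleton] at expect_sub_le
  linarith [M.abs_expect_terminalValue_sub_le
    (iidMass_mem_stdSimplex (M.trajProb_mem_stdSimplex π)) hlater hc hπ he expect_sub_le prob_le
    prob_le' hr]

end EpisodicMDP

end TerminalError

section Observed

variable {S A : Type} {T : ℕ} {ι : Type}

/-- The actions recorded in the trajectories `D i`, `i ∈ J`, at the times and states visited
there. Where several actions are recorded, one of them is selected. -/
def observed [DecidableEq S] (J : Finset ι) (D : ι → Traj S A T) : PartialPolicy S A T :=
  fun t s => (J.toList.find? fun i => (D i t).1 = s).map fun i => (D i t).2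

variable {J : Finset ι} {D : ι → Traj S A T}

theorem dependsOn_observed [DecidableEq S] (J : Finset ι) :
    DependsOn (observed J : (ι → Traj S A T) → PartialPolicy S A T) J := by
  intro D D' h
  have agree (i) (hi : i ∈ J.toList) : D i = D' i := h i (Finset.mem_toList.1 hi)
  funext t s
  rw [observed, observed, List.find?_congr fun i hi => by rw [agree i hi]]
  exact Option.map_congr fun i hi => by rw [agree i (List.mem_of_find?_eq_some hi)]

theorem observed_eq_none_iff [DecidableEq S] {t : Fin (T + 1)} {s : S} :
    observed J D t s = none ↔ ∀ i ∈ J, (D i t).1 ≠ s := by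
  simp only [observed, Option.map_eq_none_iff, List.find?_eq_none, Finset.mem_toList,
    decide_eq_true_eq, ne_eq]

theorem exists_eq_of_mem_observed [DecidableEq S] {t : Fin (T + 1)} {s : S} {a : A}
    (ha : a ∈ observed J D t s) : ∃ i ∈ J, D i t = (s, a) := by
  obtain ⟨i, hi, hia⟩ := Option.map_eq_some_iff.1 ha
  exact ⟨i, Finset.mem_toList.1 (List.mem_of_find?_eq_some hi),
    Prod.ext (by simpa only [decide_eq_true_eq] using List.find?_some hi) hia⟩

theorem DetPolicy.extends_observed [DecidableEq S] {π : DetPolicy S A T}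
    (hD : ∀ i ∈ J, ∀ t, (D i t).2 = π t (D i t).1) : DetPolicy.Extends π (observed J D) :=
  fun t s a ha => by
    obtain ⟨i, hi, hit⟩ := exists_eq_of_mem_observed ha
    simpa only [hit] using (hD i hi t).symm

theorem RandPolicy.Extends.prob_eq_one_of_mem [DecidableEq S] [Fintype A] {π : RandPolicy S A T}
    (hπ : π.Extends (observed J D)) {πE : DetPolicy S A T}
    (hD : ∀ i ∈ J, ∀ t, (D i t).2 = πE t (D i t).1) {i : ι} (hi : i ∈ J) (t : Fin (T + 1)) :
    π.prob t (D i t).1 (πE t (D i t).1) = 1 := by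
  obtain ⟨a, ha⟩ := Option.ne_none_iff_exists'.1 fun h =>
    observed_eq_none_iff.1 h i hi (rfl : (D i t).1 = (D i t).1)
  rw [DetPolicy.extends_observed hD t _ a ha]
  exact hπ t _ a ha

variable [Fintype S] [Fintype A]

namespace EpisodicMDP

theorem action_eq_of_trajProb_ne_zero [DecidableEq A] {M : EpisodicMDP S A T}
    {π : DetPolicy S A T} {τ : Traj S A T} (hτ : M.trajProb π.toRand τ ≠ 0) (t : Fin (T + 1)) :
    (τ t).2 = π t (τ t).1 :=
  by_contra fun h => Finset.prod_ne_zero_iff.1 (right_ne_zero_of_mul hτ) t (Finset.mem_univ t)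
    (if_neg h)

variable (M : EpisodicMDP S A T) [Fintype ι] [DecidableEq ι] {n δ : ℝ}

theorem prob_exists_observed_eq_none_le [DecidableEq S] (π : RandPolicy S A T) (hδ : 0 ≤ δ)
    (hJ : n ≤ J.card) :
    prob (iidMass (M.trajProb π))
        {D | ∃ t s, δ < M.stateDist π t s ∧ observed J D t s = none} ≤
      (T + 1) * Fintype.card S * Real.exp (-(n * δ)) := by
  have hτ := M.trajProb_mem_stdSimplex π
  have hD := (iidMass_mem_stdSimplex (ι := ι) hτ).1
  let unobserved (p : Fin (T + 1) × S) : Set (ι → Traj S A T) :=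
    {D | δ < M.stateDist π p.1 p.2 ∧ observed J D p.1 p.2 = none}
  have prob_unobserved_le (p) :
      prob (iidMass (M.trajProb π)) (unobserved p) ≤ Real.exp (-(n * δ)) := by
    obtain hp | hp := lt_or_ge δ (M.stateDist π p.1 p.2)
    · have visit_prob : prob (M.trajProb π) {τ | (τ p.1).1 = p.2} = M.stateDist π p.1 p.2 :=
        (M.expect_trajProb_state π p.1 (({p.2} : Set S).indicator 1)).trans (prob_singleton _ _)
      calc prob (iidMass (M.trajProb π)) (unobserved p)
          ≤ prob (iidMass (M.trajProb π)) {D | ∀ i ∈ J, D i ∉ {τ | (τ p.1).1 = p.2}} :=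
            prob_mono hD fun D hD => observed_eq_none_iff.1 hD.2
        _ ≤ Real.exp (-(J.card * M.stateDist π p.1 p.2)) :=
            visit_prob ▸ prob_forall_notMem_le_exp hτ J _
        _ ≤ Real.exp (-(n * δ)) := Real.exp_le_exp.2 <| neg_le_neg <|
            mul_le_mul hJ hp.le hδ (Nat.cast_nonneg _)
    · have empty : unobserved p = ∅ := Set.eq_empty_of_forall_notMem fun D hD => hp.not_gt hD.1
      simpa only [empty, prob, expect, Set.indicator_empty, mul_zero, Finset.sum_const_zero] using
        Real.exp_nonneg _
  calc prob (iidMass (M.trajProb π)) {D | ∃ t s, δ < M.stateDist π t s ∧ observed J D t s = none}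
      ≤ prob (iidMass (M.trajProb π)) (⋃ p, unobserved p) :=
        prob_mono hD fun D ⟨t, s, h⟩ => Set.mem_iUnion.2 ⟨(t, s), h⟩
    _ ≤ ∑ p, prob (iidMass (M.trajProb π)) (unobserved p) := prob_iUnion_le hD _
    _ ≤ ∑ _p : Fin (T + 1) × S, Real.exp (-(n * δ)) :=
        Finset.sum_le_sum fun p _ => prob_unobserved_le p
    _ = (T + 1) * Fintype.card S * Real.exp (-(n * δ)) := by
        simp only [Finset.sum_const, Finset.card_univ, Fintype.card_prod, Fintype.card_fin,
          nsmul_eq_mul, Nat.cast_mul, Nat.cast_add, Nat.cast_one]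

theorem exists_learner_of_disjoint [DecidableEq S] [DecidableEq A] [Nonempty A]
    (hS : Fintype.card S ≤ 3) (hδ : 0 < δ) {Ia Ib : Finset ι} (hdisj : Disjoint J (Ia ∪ Ib))
    (hab : Disjoint Ia Ib) (hIa : Ia.Nonempty) (hIb : Ib.Nonempty) (hJ : n ≤ J.card)
    (ha : n ≤ Ia.card) (hb : n ≤ Ib.card) :
    ∃ L : (ι → Traj S A T) → RandPolicy S A T, (∀ D, (L D).Extends (observed J D)) ∧
      ∀ (πE : DetPolicy S A T) (r : S → A → ℝ), (∀ s a, r s a ∈ Set.Icc 0 1) →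
        |expect (iidMass (M.trajProb πE.toRand)) (fun D => M.terminalValue (L D) r) -
          M.terminalValue πE.toRand r| ≤
        204 * δ + deviationBias T n (3 * δ) + (T + 1) * Fintype.card S * Real.exp (-(n * δ)) := by
  choose e he hdep hmatch using fun κ : PartialPolicy S A T =>
    M.exists_matching_terminalValue κ hS hδ hab hIa hIb ha hb
  refine ⟨fun D => e (observed J D) D, fun D => he _ D, fun πE r hr => ?_⟩
  set W : (ι → Traj S A T) → ℝ := iidMass (M.trajProb πE.toRand)
  have hτ := M.trajProb_mem_stdSimplex πE.toRand
  have hW : W ∈ stdSimplex ℝ (ι → Traj S A T) := iidMass_mem_stdSimplex hτ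
  have resample (D D' : ι → Traj S A T) : e (observed J (J.piecewise D D')) (J.piecewise D D') =
      e (observed J D) D' := by
    rw [dependsOn_observed J fun i hi => J.piecewise_eq_of_mem D D' hi]
    exact hdep _ fun i hi => J.piecewise_eq_of_notMem D D' (Finset.disjoint_right.1 hdisj hi)
  have terminalValue_mem (π : RandPolicy S A T) : M.terminalValue π r ∈ Set.Icc (0 : ℝ) 1 :=
    M.terminalValue_mem_Icc π hr
  rw [← expect_iidMass_piecewise hτ J]
  simp only [resample]
  rw [← expect_const hW (M.terminalValue πE.toRand r), ← expect_sub]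
  refine (abs_expect_le hW.1).trans ((expect_le_add_mul_prob hW (K := 1)
    (a := 204 * δ + deviationBias T n (3 * δ)) (fun D hD hobs => ?_) fun D => ?_).trans
    (add_le_add_right ((one_mul _).trans_le
      (M.prob_exists_observed_eq_none_le πE.toRand hδ.le hJ)) _))
  · have hext := DetPolicy.extends_observed (J := J) fun i _ t =>
      action_eq_of_trajProb_ne_zero (ne_zero_of_iidMass_ne_zero hD i) t
    exact hmatch _ πE.toRand hext.toRand
      (fun t s hts => not_lt.1 fun hlt => hobs ⟨t, s, hlt, hts⟩) r hr
  · have mean_mem := expect_mem_Icc hW fun D' => terminalValue_mem (e (observed J D) D')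
    have target_mem := terminalValue_mem πE.toRand
    have bias_nonneg := deviationBias_nonneg T n (show 0 ≤ 3 * δ by positivity)
    linarith [abs_sub_le_of_nonneg_of_le mean_mem.1 mean_mem.2 target_mem.1 target_mem.2]

end EpisodicMDP

end Observed

section Rate

theorem exists_disjoint_blocks {ι : Type*} [Fintype ι] [DecidableEq ι] {J : Finset ι} {m : ℕ}
    (hm : 2 * m ≤ Jᶜ.card) : ∃ Ia Ib : Finset ι, Ia.card = m ∧ Ib.card = m ∧ Disjoint Ia Ib ∧
      Disjoint J (Ia ∪ Ib) := by
  obtain ⟨Ia, hIa, hacard⟩ := Finset.exists_subset_card_eq (show m ≤ Jᶜ.card by omega)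
  obtain ⟨Ib, hIb, hbcard⟩ := Finset.exists_subset_card_eq
    (show m ≤ (Jᶜ \ Ia).card by rw [Finset.card_sdiff_of_subset hIa]; omega)
  exact ⟨Ia, Ib, hacard, hbcard, Finset.disjoint_sdiff.mono_right hIb,
    disjoint_compl_right.mono_right (Finset.union_subset hIa (hIb.trans Finset.sdiff_subset))⟩

theorem one_le_one_add_log (N T : ℕ) : (1 : ℝ) ≤ 1 + Real.log (N * (T + 1)) :=
  le_add_of_nonneg_right <| by exact_mod_cast Real.log_natCast_nonneg (N * (T + 1))

/-- The resolution `δ` makes the exponent of `deviationBias T (N / 8) (3 * δ)` equal to `-2 * ℓ`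
with `ℓ = 1 + log (N * (T + 1))`, so that every exponential is at most `(N * (T + 1)) ^ (-2)`.
The constant is `204 * 16384 + 9 * 4 + 3`. -/
theorem error_le_log_div {N : ℕ} (hN : 0 < N) (T : ℕ) {c ℓ δ : ℝ} (hc : c ≤ 3)
    (hℓ : ℓ = 1 + Real.log (N * (T + 1))) (hδ : δ = 16384 * ℓ / N) :
    204 * δ + deviationBias T (N / 8) (3 * δ) + (T + 1) * c * Real.exp (-(N / 8 * δ)) ≤
      3342375 * ℓ / N := by
  have hN1 : (1 : ℝ) ≤ N := by exact_mod_cast hN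
  have hℓ1 : 1 ≤ ℓ := hℓ ▸ one_le_one_add_log N T
  have hNδ : N * δ = 16384 * ℓ := by rw [hδ]; field_simp
  have hδ0 : 0 < δ := by rw [hδ]; positivity
  set x : ℝ := N * (T + 1) with hx
  have hNx : (N : ℝ) ≤ x := le_mul_of_one_le_right (by positivity) (by simp)
  have hTx : (T : ℝ) + 1 ≤ x := le_mul_of_one_le_left (by positivity) hN1
  have hx0 : 0 < x := by positivity
  have exp_le {y : ℝ} (hy : 2 * ℓ ≤ y) : Real.exp (-y) ≤ 1 / x ^ 2 := by
    calc Real.exp (-y) ≤ Real.exp (-Real.log (x ^ 2)) :=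
          Real.exp_le_exp.2 (by rw [Real.log_pow, Nat.cast_ofNat]; linarith)
      _ = 1 / x ^ 2 := by rw [Real.exp_neg, Real.exp_log (by positivity), one_div]
  have inv_le : 1 / x ≤ ℓ / N := div_le_div₀ (by linarith) hℓ1 (by positivity) hNx
  have bias_le : deviationBias T (N / 8) (3 * δ) ≤ 36 * (ℓ / N) := by
    have hinv : 1 / (3 * δ) ≤ N := by
      rw [div_le_iff₀ (by positivity)]
      linarith
    have factor_le : 1 + ((T : ℝ) + 1) * (2 + 1 / (3 * δ)) ≤ 4 * x := by
      linarith [mul_le_mul_of_nonneg_left hinv (by positivity : (0 : ℝ) ≤ T + 1),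
        (by rw [hx]; ring : x = (T + 1) * N)]
    calc deviationBias T (N / 8) (3 * δ) ≤ 9 * (4 * x) * (1 / x ^ 2) :=
          mul_le_mul (by linarith) (exp_le (by linarith)) (Real.exp_nonneg _) (by positivity)
      _ = 36 * (1 / x) := by field_simp; norm_num
      _ ≤ 36 * (ℓ / N) := by gcongr
  have unobserved_le : (T + 1) * c * Real.exp (-(N / 8 * δ)) ≤ 3 * (ℓ / N) := by
    calc (T + 1) * c * Real.exp (-(N / 8 * δ)) ≤ x * 3 * (1 / x ^ 2) :=
          mul_le_mul (mul_le_mul_of_nonneg hTx hc (by positivity) (by norm_num))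
            (exp_le (by linarith)) (Real.exp_nonneg _) (by positivity)
      _ = 3 * (1 / x) := by field_simp
      _ ≤ 3 * (ℓ / N) := by gcongr
  calc 204 * δ + deviationBias T (N / 8) (3 * δ) + (T + 1) * c * Real.exp (-(N / 8 * δ))
      ≤ 204 * (16384 * ℓ / N) + 36 * (ℓ / N) + 3 * (ℓ / N) := by rw [← hδ]; gcongr
    _ = 3342375 * ℓ / N := by ring

end Rate

section Learner

variable {S A : Type} {T N : ℕ}

/-- The first `⌊N / 2⌋` of `N` indices. -/
def firstHalf (N : ℕ) : Finset (Fin N) := {i | (i : ℕ) < N / 2}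

theorem card_firstHalf (N : ℕ) : (firstHalf N).card = N / 2 := by
  rw [firstHalf, Fin.card_filter_val_lt, min_eq_right (Nat.div_le_self N 2)]

theorem RandPolicy.Extends.mimicsFirstHalf [DecidableEq S] [Fintype A] {π : RandPolicy S A T}
    {D : Dataset S A T N} (hπ : π.Extends (observed (firstHalf N) D)) {πE : DetPolicy S A T}
    (hD : PlayedBy πE D) : MimicsFirstHalf πE D π :=
  fun i hi t => hπ.prob_eq_one_of_mem (fun i _ => hD i)
    (Finset.mem_filter.2 ⟨Finset.mem_univ i, hi⟩) t

variable [Fintype S] [Fintype A]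

theorem tvDist_le_of_forall_test {p q : S → A → ℝ} {ε : ℝ}
    (h : ∀ r : S → A → ℝ, (∀ s a, r s a ∈ Set.Icc 0 1) →
      |∑ s, ∑ a, (p s a - q s a) * r s a| ≤ ε) : tvDist p q ≤ ε := by
  have hpos := h (fun s a => if q s a < p s a then 1 else 0) fun s a => by split_ifs <;> simp
  have hneg := h (fun s a => if q s a < p s a then 0 else 1) fun s a => by split_ifs <;> simp
  have split : ∑ s, ∑ a, |p s a - q s a| =
      ∑ s, ∑ a, (p s a - q s a) * (if q s a < p s a then 1 else 0) -
        ∑ s, ∑ a, (p s a - q s a) * (if q s a < p s a then 0 else 1) := by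
    simp only [← Finset.sum_sub_distrib]
    refine Finset.sum_congr rfl fun s _ => Finset.sum_congr rfl fun a _ => ?_
    split_ifs with hlt
    · rw [abs_of_pos (sub_pos.2 hlt)]; ring
    · rw [abs_of_nonpos (sub_nonpos.2 (not_lt.1 hlt))]; ring
  rw [tvDist, split]
  linarith [(abs_le.1 hpos).2, (abs_le.1 hneg).1]

variable [DecidableEq S] [DecidableEq A]

theorem EpisodicMDP.exists_learner [Nonempty A] (M : EpisodicMDP S A T)
    (hS : Fintype.card S ≤ 3) (hN : 0 < N) :
    ∃ L : Learner S A T N, (∀ D, (L D).Extends (observed (firstHalf N) D)) ∧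
      ∀ (πE : DetPolicy S A T) (r : S → A → ℝ), (∀ s a, r s a ∈ Set.Icc 0 1) →
        |expect (iidMass (M.trajProb πE.toRand)) (fun D => M.terminalValue (L D) r) -
          M.terminalValue πE.toRand r| ≤ 3342375 * (1 + Real.log (N * (T + 1))) / N := by
  have hℓ := one_le_one_add_log N T
  obtain hN4 | hN4 := lt_or_ge N 4
  · choose π hπ using fun D : Dataset S A T N => DetPolicy.exists_extends (observed (firstHalf N) D)
    refine ⟨fun D => (π D).toRand, fun D => (hπ D).toRand, fun πE r hr => ?_⟩
    have value_mem (π : RandPolicy S A T) : M.terminalValue π r ∈ Set.Icc (0 : ℝ) 1 :=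
      M.terminalValue_mem_Icc π hr
    have mean_mem := expect_mem_Icc (iidMass_mem_stdSimplex (ι := Fin N)
      (M.trajProb_mem_stdSimplex πE.toRand)) fun D => value_mem (π D).toRand
    refine (abs_sub_le_of_nonneg_of_le mean_mem.1 mean_mem.2 (value_mem _).1
      (value_mem _).2).trans ?_
    rw [le_div_iff₀ (by positivity)]
    have N_le_four : (N : ℝ) ≤ 4 := by exact_mod_cast hN4.le
    linarith
  · obtain ⟨Ia, Ib, ha, hb, hab, hdisj⟩ :=
      exists_disjoint_blocks (J := firstHalf N) (m := N / 4)
        (by rw [Finset.card_compl, card_firstHalf, Fintype.card_fin]; omega)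
    have div_le {m : ℕ} (hm : N ≤ m * 8) : (N : ℝ) / 8 ≤ m := by
      rw [div_le_iff₀ (by norm_num)]
      exact_mod_cast hm
    obtain ⟨L, hL, hbound⟩ := M.exists_learner_of_disjoint hS
      (show 0 < 16384 * (1 + Real.log (N * (T + 1))) / N by positivity) hdisj hab
      (Finset.card_pos.1 (by omega)) (Finset.card_pos.1 (by omega))
      (div_le (by rw [card_firstHalf]; omega)) (div_le (by omega)) (div_le (by omega))
    exact ⟨L, hL, fun πE r hr => (hbound πE r hr).trans
      (error_le_log_div hN T (Nat.cast_le_ofNat.2 hS) rfl rfl)⟩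

theorem EpisodicMDP.sum_sum_expect_occ_mul (M : EpisodicMDP S A T) {X : Type*} [Fintype X]
    (w : X → ℝ) (e : X → RandPolicy S A T) (r : S → A → ℝ) :
    ∑ s, ∑ a, expect w (fun x => M.occ (e x) (Fin.last T) s a) * r s a =
      expect w fun x => M.terminalValue (e x) r := by
  simp only [← sum_occ_mul, expect_sum, expect_mul_const]

end Learner

theorem mainTheorem7_general : ∃ C > 0,
    ∀ (S A : Type) [Fintype S] [DecidableEq S] [Fintype A] [DecidableEq A] [Nonempty A] (T N : ℕ),
      Fintype.card S ≤ 3 → 0 < N → ∀ M : EpisodicMDP S A T,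
      ∃ L : Learner S A T N, ∀ πE : DetPolicy S A T,
        (∀ D, PlayedBy πE D → MimicsFirstHalf πE D (L D)) ∧
        tvDist (fun s a => M.dataExp πE.toRand (fun D => M.occ (L D) (Fin.last T) s a))
            (M.occ πE.toRand (Fin.last T))
          ≤ C * (1 + Real.log ((N : ℝ) * ((T : ℝ) + 1))) / N ∧
        ∀ r : Fin (T + 1) → S → A → ℝ,
          (∀ t s a, 0 ≤ r t s a ∧ r t s a ≤ 1) →
          (∀ t s a, t ≠ Fin.last T → r t s a = 0) →
          |M.value r πE.toRand - M.dataExp πE.toRand (fun D => M.value r (L D))|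
            ≤ C * (1 + Real.log ((N : ℝ) * ((T : ℝ) + 1))) / N := by
  refine ⟨3342375, by norm_num, fun S A _ _ _ _ _ T N hS hN M => ?_⟩
  obtain ⟨L, hL, hbound⟩ := M.exists_learner hS hN
  refine ⟨L, fun πE => ⟨fun D hD => (hL D).mimicsFirstHalf hD, ?_, fun r hr hlast => ?_⟩⟩
  · refine tvDist_le_of_forall_test fun r hr => (congrArg abs ?_).trans_le (hbound πE r hr)
    simp only [sub_mul, Finset.sum_sub_distrib, M.sum_occ_mul]
    exact congrArg (· - _) (M.sum_sum_expect_occ_mul (iidMass (M.trajProb πE.toRand)) L r)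
  · rw [abs_sub_comm]
    simp only [M.value_eq_terminalValue _ hlast]
    exact hbound πE (r (Fin.last T)) (hr _)

end

theorem mainTheorem7 :
    ∃ (C : ℝ) (k : ℕ), 0 < C ∧
      ∀ (A : Type) [Fintype A] [DecidableEq A] [Nonempty A] (T N : ℕ), 0 < N →
      ∀ M : EpisodicMDP (Fin 3) A T,
      ∃ L : Learner (Fin 3) A T N,
      ∀ πE : DetPolicy (Fin 3) A T,
        (∀ D, PlayedBy πE D → MimicsFirstHalf πE D (L D)) ∧
        tvDist (fun s a => M.dataExp πE.toRand (fun D => M.occ (L D) (Fin.last T) s a))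
            (M.occ πE.toRand (Fin.last T))
          ≤ C * (1 + Real.log ((N : ℝ) * ((T : ℝ) + 1))) ^ k / N ∧
        ∀ r : Fin (T + 1) → Fin 3 → A → ℝ,
          (∀ t s a, 0 ≤ r t s a ∧ r t s a ≤ 1) →
          (∀ t s a, t ≠ Fin.last T → r t s a = 0) →
          |M.value r πE.toRand - M.dataExp πE.toRand (fun D => M.value r (L D))|
            ≤ C * (1 + Real.log ((N : ℝ) * ((T : ℝ) + 1))) ^ k / N := by
  obtain ⟨C, hC, h⟩ := mainTheorem7_general
  exact ⟨C, 1, hC, fun A _ _ _ T N hN M => by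
    simpa only [pow_one] using h (Fin 3) A T N (Fintype.card_fin 3).le hN M⟩
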